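/- **Setup.** Let $(V,\psi)$ be a finite-dimensional symplectic space over $\mathbb{Q}$, and let $(G,X)$ be a Shimura datum of Hodge type with a closed embedding of Shimura data $(G,X)\hookrightarrow(\mathrm{GSp}(V,\psi),\mathfrak{H}_V)$, where $\mathfrak{H}_V$ is the union of the Siegel upper and lower half spaces; let $c\colon G\to\mathbb{G}_m$ be the restriction of the similitude character. Let $F$ be a totally real number field that is Galois over $\mathbb{Q}$, and $\Gamma=\mathrm{Gal}(F/\mathbb{Q})$. Put $H=\mathrm{Res}_{F/\mathbb{Q}}G_F$, and let $Y$ be the $H(\mathbb{R})$-conjugacy class of the composite $\mathbb{S}\xrightarrow{h}G_{\mathbb{R}}\to H_{\mathbb{R}}$ for $h\in X$. Let $H_1$ be the neutral component of the fibre product $H\times_{\mathrm{Res}_{F/\mathbb{Q}}\mathbb{G}_m}\mathbb{G}_m$ (formed with the map $H\to\mathrm{Res}_{F/\mathbb{Q}}\mathbb{G}_m$ induced by $c$); the map $G\to H$ factors through $H_1$, and $Y_1$ is the $H_1(\mathbb{R})$-conjugacy class of $\mathbb{S}\xrightarrow{h}G_{\mathbb{R}}\to H_{1,\mathbb{R}}$.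 The group $\Gamma$ acts on $H$, $H_1$, $Y$ and $Y_1$. For a group $A$ acting on a set $Z$, with compatible actions of $\Gamma$ on $A$ and $Z$ (i.e. $\gamma(az)=\gamma(a)\gamma(z)$), write $[A\backslash Z]$ for the action groupoid and $[A\backslash Z]^{h\Gamma}$ for its groupoid of homotopy fixed points: the objects are pairs $(z,(\tau_\gamma)_{\gamma\in\Gamma})$ with $z\in Z$, $\tau_\gamma\in A$, $\tau_\gamma z=\gamma(z)$ and $\gamma'(\tau_\gamma)\,\tau_{\gamma'}=\tau_{\gamma'\gamma}$ for all $\gamma,\gamma'$; a morphism $(z,\tau)\to(z',\tau')$ is an $a\in A$ with $az=z'$ and $\gamma(a)\tau_\gamma=\tau'_\gamma a$ for all $\gamma$. **Proposition 3.13.** Let $\ell$ be a prime not dividing $|\Gamma|$. Let $K^\ell\subset H(\mathbb{A}_f^\ell)$ be a neat compact open subgroup that is good, i.e. $\Gamma$-stable with $H^1(\Gamma,K^\ell)=\{1\}$, and let $K_\ell\subset H(\mathbb{Q}_\ell)$ be a $\Gamma$-stable pro-$\ell$ subgroup. Put $K_1^\ell=K^\ell\cap H_1(\mathbb{A}_f^\ell)$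 and $K_{1,\ell}=K_\ell\cap H_1(\mathbb{Q}_\ell)$. Then the functor $(z,\tau)\mapsto H_1(\mathbb{Q})z$ is an equivalence $$\left[H_1(\mathbb{Q})\backslash Y_1\times H_1(\mathbb{A}_f)/K_1^\ell K_{1,\ell}\right]^{h\Gamma}\;\xrightarrow{\ \sim\ }\;\left(H_1(\mathbb{Q})\backslash Y_1\times H_1(\mathbb{A}_f)/K_1^\ell K_{1,\ell}\right)^{\Gamma},$$ where the set on the right is regarded as a discrete groupoid, and the natural functor $$\left(H_1(\mathbb{Q})\backslash Y_1\times H_1(\mathbb{A}_f)/K_1^\ell K_{1,\ell}\right)^{\Gamma}\longrightarrow\left[H(\mathbb{Q})\backslash Y\times H(\mathbb{A}_f)/K^\ell K_{1,\ell}\right]^{h\Gamma}$$ obtained from a quasi-inverse of this equivalence and the inclusion $H_1\to H$ is fully faithful. In particular it is injective on isomorphism classes. -/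

import Mathlib

open scoped TensorProduct Matrix RestrictedProduct
open CategoryTheory IsDedekindDomain

noncomputable section

namespace PiatetskiShapiro

/-! ### Group functors on commutative `ℚ`-algebras -/

/-- A functor from commutative `ℚ`-algebras to groups. (Every ring homomorphism between
`ℚ`-algebras is `ℚ`-linear, so `map` takes arbitrary ring homomorphisms.) -/
structure GroupFunctor where
  obj (R : Type) [CommRing R] [Algebra ℚ R] : Type
  [group (R : Type) [CommRing R] [Algebra ℚ R] : Group (obj R)]
  map {R S : Type} [CommRing R] [Algebra ℚ R] [CommRing S] [Algebra ℚ S] (f : R →+* S) :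
    obj R →* obj S
  map_id (R : Type) [CommRing R] [Algebra ℚ R] (g : obj R) : map (RingHom.id R) g = g
  map_comp {R S T : Type} [CommRing R] [Algebra ℚ R] [CommRing S] [Algebra ℚ S]
    [CommRing T] [Algebra ℚ T] (f : R →+* S) (f' : S →+* T) (g : obj R) :
    map (f'.comp f) g = map f' (map f g)

attribute [instance] GroupFunctor.group

/-- `R ↦ GL_n(R)`. -/
def GLFunctor (n : Type) [Fintype n] [DecidableEq n] : GroupFunctor where
  obj R _ _ := GL n R
  map f := Matrix.GeneralLinearGroup.map f
  map_id R _ _ g := by rw [Matrix.GeneralLinearGroup.map_id]; rfl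
  map_comp _ _ _ := rfl

/-- The ring homomorphism `R ⊗ F → S ⊗ F` induced by `R → S`. -/
def baseMap (F : Type) [Field F] [Algebra ℚ F] {R S : Type} [CommRing R] [Algebra ℚ R]
    [CommRing S] [Algebra ℚ S] (f : R →+* S) : R ⊗[ℚ] F →+* S ⊗[ℚ] F :=
  (Algebra.TensorProduct.map f.toRatAlgHom (AlgHom.id ℚ F)).toRingHom

/-- The ring automorphism `1 ⊗ γ` of `R ⊗ F`. -/
def galMap {F : Type} [Field F] [Algebra ℚ F] (γ : F ≃ₐ[ℚ] F) (R : Type) [CommRing R]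
    [Algebra ℚ R] : R ⊗[ℚ] F →+* R ⊗[ℚ] F :=
  (Algebra.TensorProduct.map (AlgHom.id ℚ R) γ.toAlgHom).toRingHom

/-- The Weil restriction `Res_{F/ℚ}` of the base change to `F`: `R ↦ 𝒜(R ⊗ F)`. -/
def GroupFunctor.weilRes (𝒜 : GroupFunctor) (F : Type) [Field F] [Algebra ℚ F] :
    GroupFunctor where
  obj R _ _ := 𝒜.obj (R ⊗[ℚ] F)
  map f := 𝒜.map (baseMap F f)
  map_id R _ _ g := by
    have : baseMap F (RingHom.id R) = RingHom.id (R ⊗[ℚ] F) := by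
      ext x <;> simp [baseMap]
    rw [this, 𝒜.map_id]
  map_comp {R S T} _ _ _ _ _ _ f f' g := by
    have : baseMap F (f'.comp f) = (baseMap F f').comp (baseMap F f) := by
      ext x <;> simp [baseMap]
    rw [this, 𝒜.map_comp]

/-- Homomorphisms of group functors. -/
structure GroupFunctor.Hom (𝒜 ℬ : GroupFunctor) where
  app (R : Type) [CommRing R] [Algebra ℚ R] : 𝒜.obj R →* ℬ.obj R
  naturality {R S : Type} [CommRing R] [Algebra ℚ R] [CommRing S] [Algebra ℚ S] (f : R →+* S)
    (g : 𝒜.obj R) : ℬ.map f (app R g) = app S (𝒜.map f g)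

/-- The natural map from a group functor to the Weil restriction of its base change. -/
def GroupFunctor.toWeilRes (𝒜 : GroupFunctor) (F : Type) [Field F] [Algebra ℚ F] :
    𝒜.Hom (𝒜.weilRes F) where
  app R _ _ := 𝒜.map (Algebra.TensorProduct.includeLeftRingHom : R →+* R ⊗[ℚ] F)
  naturality {R S} _ _ _ _ f g := by
    have e : (baseMap F f).comp (Algebra.TensorProduct.includeLeftRingHom : R →+* R ⊗[ℚ] F) =
        (Algebra.TensorProduct.includeLeftRingHom : S →+* S ⊗[ℚ] F).comp f := by
      ext x
      simp [baseMap]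
    exact (𝒜.map_comp _ _ g).symm.trans ((congrArg (fun r => 𝒜.map r g) e).trans
      (𝒜.map_comp _ _ g))

/-- The action of `γ ∈ Gal(F/ℚ)` on the Weil restriction. -/
def GroupFunctor.gal (𝒜 : GroupFunctor) {F : Type} [Field F] [Algebra ℚ F] (γ : F ≃ₐ[ℚ] F) :
    (𝒜.weilRes F).Hom (𝒜.weilRes F) where
  app R _ _ := 𝒜.map (galMap γ R)
  naturality {R S} _ _ _ _ f g := by
    have e : (baseMap F f).comp (galMap γ R) = (galMap γ S).comp (baseMap F f) := by
      ext x <;> simp [baseMap, galMap]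
    exact (𝒜.map_comp _ _ (g : 𝒜.obj (R ⊗[ℚ] F))).symm.trans
      ((congrArg (fun r => 𝒜.map r (g : 𝒜.obj (R ⊗[ℚ] F))) e).trans (𝒜.map_comp _ _ _))

theorem GroupFunctor.gal_one (𝒜 : GroupFunctor) {F : Type} [Field F] [Algebra ℚ F] (R : Type)
    [CommRing R] [Algebra ℚ R] (g : (𝒜.weilRes F).obj R) :
    (𝒜.gal (1 : F ≃ₐ[ℚ] F)).app R g = g := by
  have e : galMap (1 : F ≃ₐ[ℚ] F) R = RingHom.id _ := by ext x <;> simp [galMap]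
  exact (congrArg (fun r => 𝒜.map r (g : 𝒜.obj (R ⊗[ℚ] F))) e).trans (𝒜.map_id _ _)

theorem GroupFunctor.gal_mul (𝒜 : GroupFunctor) {F : Type} [Field F] [Algebra ℚ F]
    (γ δ : F ≃ₐ[ℚ] F) (R : Type) [CommRing R] [Algebra ℚ R] (g : (𝒜.weilRes F).obj R) :
    (𝒜.gal (γ * δ)).app R g = (𝒜.gal γ).app R ((𝒜.gal δ).app R g) := by
  have e : galMap (γ * δ) R = (galMap γ R).comp (galMap δ R) := by ext x <;> simp [galMap]
  exact (congrArg (fun r => 𝒜.map r (g : 𝒜.obj (R ⊗[ℚ] F))) e).trans (𝒜.map_comp _ _ _)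

theorem GroupFunctor.gal_toWeilRes (𝒜 : GroupFunctor) {F : Type} [Field F] [Algebra ℚ F]
    (γ : F ≃ₐ[ℚ] F) (R : Type) [CommRing R] [Algebra ℚ R] (g : 𝒜.obj R) :
    (𝒜.gal γ).app R ((𝒜.toWeilRes F).app R g) = (𝒜.toWeilRes F).app R g := by
  have e : (galMap γ R).comp (Algebra.TensorProduct.includeLeftRingHom : R →+* R ⊗[ℚ] F) =
      Algebra.TensorProduct.includeLeftRingHom := by
    ext x
    simp [galMap]
  exact (𝒜.map_comp _ _ g).symm.trans (congrArg (fun r => 𝒜.map r g) e)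

/-- A subgroup functor. -/
structure SubgroupFunctor (𝒜 : GroupFunctor) where
  obj (R : Type) [CommRing R] [Algebra ℚ R] : Subgroup (𝒜.obj R)
  map_mem {R S : Type} [CommRing R] [Algebra ℚ R] [CommRing S] [Algebra ℚ S] (f : R →+* S)
    {g : 𝒜.obj R} (hg : g ∈ obj R) : 𝒜.map f g ∈ obj S

/-- Functoriality of a subgroup functor. -/
def SubgroupFunctor.map {𝒜 : GroupFunctor} (P : SubgroupFunctor 𝒜) {R S : Type} [CommRing R]
    [Algebra ℚ R] [CommRing S] [Algebra ℚ S] (f : R →+* S) : P.obj R →* P.obj S :=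
  ((𝒜.map f).comp (P.obj R).subtype).codRestrict (P.obj S) fun g => P.map_mem f g.2

/-- A subgroup functor of a Weil restriction that is stable under `Gal(F/ℚ)`. -/
structure GalSubgroup (F : Type) [Field F] [Algebra ℚ F] (𝒜 : GroupFunctor) extends
    SubgroupFunctor (𝒜.weilRes F) where
  gal_mem (γ : F ≃ₐ[ℚ] F) {R : Type} [CommRing R] [Algebra ℚ R] {g : (𝒜.weilRes F).obj R}
    (hg : g ∈ obj R) : (𝒜.gal γ).app R g ∈ obj R

/-- `Res_{F/ℚ} P_F : R ↦ P(R ⊗ F)`. -/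
def SubgroupFunctor.weilRes {𝒜 : GroupFunctor} (P : SubgroupFunctor 𝒜) (F : Type) [Field F]
    [Algebra ℚ F] : GalSubgroup F 𝒜 where
  obj R _ _ := P.obj (R ⊗[ℚ] F)
  map_mem f _ hg := P.map_mem (baseMap F f) hg
  gal_mem γ R _ _ _ hg := P.map_mem (galMap γ R) hg

/-- The action of `Gal(F/ℚ)` on the points of a stable subgroup functor. -/
instance GalSubgroup.instGalAction {F : Type} [Field F] [Algebra ℚ F] {𝒜 : GroupFunctor}
    (P : GalSubgroup F 𝒜) (R : Type) [CommRing R] [Algebra ℚ R] :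
    MulDistribMulAction (F ≃ₐ[ℚ] F) (P.obj R) where
  smul γ g := ⟨(𝒜.gal γ).app R g, P.gal_mem γ g.2⟩
  one_smul g := Subtype.ext (𝒜.gal_one R g.1)
  mul_smul γ δ g := Subtype.ext (𝒜.gal_mul γ δ R g.1)
  smul_mul γ g h := Subtype.ext (map_mul ((𝒜.gal γ).app R) g.1 h.1)
  smul_one γ := Subtype.ext (map_one ((𝒜.gal γ).app R))

theorem GalSubgroup.map_smul {F : Type} [Field F] [Algebra ℚ F] {𝒜 : GroupFunctor}
    (P : GalSubgroup F 𝒜) {R S : Type} [CommRing R] [Algebra ℚ R] [CommRing S] [Algebra ℚ S]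
    (f : R →+* S) (γ : F ≃ₐ[ℚ] F) (g : P.obj R) : P.map f (γ • g) = γ • P.map f g :=
  Subtype.ext ((𝒜.gal γ).naturality f g.1)

/-! ### Coordinate rings and neutral components -/

/-- A commutative algebra over a field `k` (together with its `ℚ`-algebra structure). -/
structure AlgOver (k : Type) [Field k] where
  carrier : Type
  [commRing : CommRing carrier]
  [algebra : Algebra k carrier]
  [ratAlgebra : Algebra ℚ carrier]

attribute [instance] AlgOver.commRing AlgOver.algebra AlgOver.ratAlgebra

/-- `k` as an algebra over itself. -/
def AlgOver.self (k : Type) [Field k] [Algebra ℚ k] : AlgOver k := ⟨k⟩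

/-- The ring of regular functions on the base change `P_k`: natural transformations from `P_k` to
the affine line over `k`. By the Yoneda lemma this is the coordinate ring of `P_k` when `P` is
represented by an affine scheme. -/
def RegFun {𝒜 : GroupFunctor} (P : SubgroupFunctor 𝒜) (k : Type) [Field k] :
    Subring (∀ A : AlgOver k, P.obj A.carrier → A.carrier) where
  carrier := {φ | ∀ (A B : AlgOver k) (f : A.carrier →ₐ[k] B.carrier) (x : P.obj A.carrier),
    f (φ A x) = φ B (P.map (f : A.carrier →+* B.carrier) x)}
  mul_mem' {φ ψ} hφ hψ A B f x := by simp [hφ A B f x, hψ A B f x]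
  one_mem' A B f x := by simp
  add_mem' {φ ψ} hφ hψ A B f x := by simp [hφ A B f x, hψ A B f x]
  zero_mem' A B f x := by simp
  neg_mem' {φ} hφ A B f x := by simp [hφ A B f x]

/-- Evaluation of regular functions at a `k`-point. -/
def evalPoint {𝒜 : GroupFunctor} (P : SubgroupFunctor 𝒜) {k : Type} [Field k] [Algebra ℚ k]
    (x : P.obj k) : RegFun P k →+* k where
  toFun φ := φ.1 (AlgOver.self k) x
  map_one' := rfl
  map_mul' _ _ := rfl
  map_zero' := rfl
  map_add' _ _ := rfl

/-- The point of the spectrum of the coordinate ring of `P_k` given by a `k`-point. -/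
def specPoint {𝒜 : GroupFunctor} (P : SubgroupFunctor 𝒜) {k : Type} [Field k] [Algebra ℚ k]
    (x : P.obj k) : PrimeSpectrum (RegFun P k) :=
  PrimeSpectrum.comap (evalPoint P x) ⟨⊥, Ideal.isPrime_bot⟩

/-- A `k`-point of `P` lies in the connected component of the identity of `P_k`. -/
def InIdentityComponent {𝒜 : GroupFunctor} (P : SubgroupFunctor 𝒜) {k : Type} [Field k]
    [Algebra ℚ k] (x : P.obj k) : Prop :=
  specPoint P x ∈ connectedComponent (specPoint P (1 : P.obj k))

/-- A natural family of self-maps of the points of `P` induces a map on the coordinate ring. -/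
def pullback {𝒜 : GroupFunctor} (P : SubgroupFunctor 𝒜) (k : Type) [Field k]
    (t : ∀ A : AlgOver k, P.obj A.carrier → P.obj A.carrier)
    (ht : ∀ (A B : AlgOver k) (f : A.carrier →ₐ[k] B.carrier) (x : P.obj A.carrier),
      P.map (f : A.carrier →+* B.carrier) (t A x) = t B (P.map (f : A.carrier →+* B.carrier) x)) :
    RegFun P k →+* RegFun P k where
  toFun φ := ⟨fun A x => φ.1 A (t A x), fun A B f x => by
    rw [φ.2 A B f (t A x), ht A B f x]⟩
  map_one' := rfl
  map_mul' _ _ := rfl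
  map_zero' := rfl
  map_add' _ _ := rfl

theorem InIdentityComponent.transport {𝒜 : GroupFunctor} (P : SubgroupFunctor 𝒜) {k : Type}
    [Field k] [Algebra ℚ k] (t : ∀ A : AlgOver k, P.obj A.carrier → P.obj A.carrier)
    (ht : ∀ (A B : AlgOver k) (f : A.carrier →ₐ[k] B.carrier) (x : P.obj A.carrier),
      P.map (f : A.carrier →+* B.carrier) (t A x) = t B (P.map (f : A.carrier →+* B.carrier) x))
    {x y : P.obj k} (h : specPoint P x ∈ connectedComponent (specPoint P y)) :
    specPoint P (k := k) (t (AlgOver.self k) x) ∈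
      connectedComponent (specPoint P (k := k) (t (AlgOver.self k) y)) :=
  (PrimeSpectrum.continuous_comap (pullback P k t ht)).image_connectedComponent_subset
    (specPoint P y) ⟨specPoint P x, h, rfl⟩

theorem SubgroupFunctor.map_map {𝒜 : GroupFunctor} (P : SubgroupFunctor 𝒜) {R S T : Type}
    [CommRing R] [Algebra ℚ R] [CommRing S] [Algebra ℚ S] [CommRing T] [Algebra ℚ T]
    (f : R →+* S) (f' : S →+* T) (g : P.obj R) : P.map f' (P.map f g) = P.map (f'.comp f) g :=
  Subtype.ext (𝒜.map_comp f f' g.1).symm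

theorem InIdentityComponent.translate {𝒜 : GroupFunctor} (P : SubgroupFunctor 𝒜) {k : Type}
    [Field k] [Algebra ℚ k] (g : P.obj k) {x y : P.obj k}
    (h : specPoint P x ∈ connectedComponent (specPoint P y)) :
    specPoint P (g * x) ∈ connectedComponent (specPoint P (g * y)) := by
  have := InIdentityComponent.transport P
    (fun A z => P.map (algebraMap k A.carrier) g * z)
    (fun A B f z => by
      rw [map_mul, P.map_map]
      exact congrArg (fun r => P.map r g * _) (AlgHom.comp_algebraMap f)) h
  have hid : P.map (RingHom.id k) g = g := Subtype.ext (𝒜.map_id k g.1)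
  change specPoint P (P.map (RingHom.id k) g * x) ∈
    connectedComponent (specPoint P (P.map (RingHom.id k) g * y)) at this
  rw [hid] at this
  exact this

/-- The neutral component `P°` of a group functor `P` (represented by an affine group scheme of
finite type over `ℚ`): an `R`-point of `P` is a point of `P°` if at every field-valued point of
`Spec R` it lies in the connected component of the identity of the fibre. -/
def GalSubgroup.neutralComponent {F : Type} [Field F] [Algebra ℚ F] {𝒜 : GroupFunctor}
    (P : GalSubgroup F 𝒜) : GalSubgroup F 𝒜 where
  obj R _ _ :=
    { carrier := {g | ∃ hg : g ∈ P.obj R, ∀ (k : Type) [Field k] [Algebra ℚ k] (f : R →+* k),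
        InIdentityComponent P.toSubgroupFunctor (P.map f ⟨g, hg⟩)}
      one_mem' := ⟨one_mem _, fun k _ _ f => by
        have : P.map f ⟨1, one_mem _⟩ = 1 := map_one (P.map f)
        rw [this]
        exact mem_connectedComponent⟩
      mul_mem' := by
        rintro a b ⟨ha, ha'⟩ ⟨hb, hb'⟩
        refine ⟨mul_mem ha hb, fun k _ _ f => ?_⟩
        have e : P.map f ⟨a * b, mul_mem ha hb⟩ = P.map f ⟨a, ha⟩ * P.map f ⟨b, hb⟩ :=
          map_mul (P.map f) ⟨a, ha⟩ ⟨b, hb⟩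
        have h1 := InIdentityComponent.translate P.toSubgroupFunctor (P.map f ⟨a, ha⟩) (hb' k f)
        rw [mul_one] at h1
        rw [e, InIdentityComponent, connectedComponent_eq (ha' k f)]
        exact h1
      inv_mem' := by
        rintro a ⟨ha, ha'⟩
        refine ⟨inv_mem ha, fun k _ _ f => ?_⟩
        have e : P.map f ⟨a⁻¹, inv_mem ha⟩ = (P.map f ⟨a, ha⟩)⁻¹ := map_inv (P.map f) ⟨a, ha⟩
        have h1 := InIdentityComponent.translate P.toSubgroupFunctor (P.map f ⟨a, ha⟩)⁻¹ (ha' k f)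
        rw [mul_one, inv_mul_cancel] at h1
        rw [e, InIdentityComponent, ← connectedComponent_eq h1]
        exact mem_connectedComponent }
  map_mem {R S} _ _ _ _ f g := by
    rintro ⟨hg, h⟩
    refine ⟨P.map_mem f hg, fun k _ _ f' => ?_⟩
    have := h k (f'.comp f)
    rw [← P.map_map] at this
    exact this
  gal_mem γ R _ _ g := by
    rintro ⟨hg, h⟩
    refine ⟨P.gal_mem γ hg, fun k _ _ f => ?_⟩
    have := InIdentityComponent.transport P.toSubgroupFunctor (fun A x => γ • x)
      (fun A B f x => P.map_smul (f : A.carrier →+* B.carrier) γ x) (h k f)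
    have e1 : (γ • P.map f ⟨g, hg⟩) = P.map f ⟨(𝒜.gal γ).app R g, P.gal_mem γ hg⟩ :=
      (P.map_smul f γ ⟨g, hg⟩).symm
    have e2 : γ • (1 : P.obj k) = 1 := smul_one γ
    change specPoint _ (γ • P.map f ⟨g, hg⟩) ∈
      connectedComponent (specPoint _ (γ • (1 : P.obj k))) at this
    rw [e1, e2] at this
    exact this

/-! ### Linear algebraic groups -/

/-- A linear algebraic group over `k`: a closed subgroup scheme of `GL_n`, given by the ideal of
its equations in the matrix entries. -/
structure LinAlgGroup (k : Type) [Field k] (n : Type) [Fintype n] [DecidableEq n] where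
  equations : Ideal (MvPolynomial (n × n) k)
  one_mem' (R : Type) [CommRing R] [Algebra k R] : ∀ p ∈ equations,
    MvPolynomial.aeval (fun ij : n × n => (1 : GL n R).val ij.1 ij.2) p = 0
  mul_mem' (R : Type) [CommRing R] [Algebra k R] (g h : GL n R) :
    (∀ p ∈ equations, MvPolynomial.aeval (fun ij : n × n => g.val ij.1 ij.2) p = 0) →
    (∀ p ∈ equations, MvPolynomial.aeval (fun ij : n × n => h.val ij.1 ij.2) p = 0) →
    ∀ p ∈ equations, MvPolynomial.aeval (fun ij : n × n => (g * h).val ij.1 ij.2) p = 0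
  inv_mem' (R : Type) [CommRing R] [Algebra k R] (g : GL n R) :
    (∀ p ∈ equations, MvPolynomial.aeval (fun ij : n × n => g.val ij.1 ij.2) p = 0) →
    ∀ p ∈ equations, MvPolynomial.aeval (fun ij : n × n => (g⁻¹).val ij.1 ij.2) p = 0

variable {n : Type} [Fintype n] [DecidableEq n]

/-- The group of `R`-points of a linear algebraic group. -/
def LinAlgGroup.points {k : Type} [Field k] (G : LinAlgGroup k n) (R : Type) [CommRing R]
    [Algebra k R] : Subgroup (GL n R) where
  carrier := {g | ∀ p ∈ G.equations,
    MvPolynomial.aeval (fun ij : n × n => g.val ij.1 ij.2) p = 0}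
  one_mem' := G.one_mem' R
  mul_mem' {g h} := G.mul_mem' R g h
  inv_mem' {g} := G.inv_mem' R g

/-- The functor of points of a linear algebraic group over `ℚ`. -/
def LinAlgGroup.functor (G : LinAlgGroup ℚ n) : SubgroupFunctor (GLFunctor n) where
  obj R _ _ := G.points R
  map_mem {R S} _ _ _ _ f g hg p hp := by
    exact (MvPolynomial.comp_aeval_apply _ f.toRatAlgHom p).symm.trans
      ((congrArg f.toRatAlgHom (hg p hp)).trans (map_zero _))

/-- The center of `G`, as a functor: `R ↦ {z ∈ G(R) : z is central in G(S) for all R → S}`. -/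
def LinAlgGroup.InCenter (G : LinAlgGroup ℚ n) {R : Type} [CommRing R] [Algebra ℚ R]
    (z : GL n R) : Prop :=
  z ∈ G.points R ∧ ∀ (S : Type) [CommRing S] [Algebra ℚ S] (f : R →+* S), ∀ g ∈ G.points S,
    Matrix.GeneralLinearGroup.map f z * g = g * Matrix.GeneralLinearGroup.map f z

/-- Connected reductive groups over `ℚ`: the coordinate ring has connected spectrum, and over an
algebraic closure there is no nontrivial closed normal unipotent subgroup (such subgroups are
automatically smooth and connected in characteristic zero). -/
structure LinAlgGroup.IsConnectedReductive (G : LinAlgGroup ℚ n) : Prop where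
  connected : ConnectedSpace (PrimeSpectrum (RegFun G.functor ℚ))
  unipotentRadical : ∀ U : LinAlgGroup (AlgebraicClosure ℚ) n,
    U.points (AlgebraicClosure ℚ) ≤ G.points (AlgebraicClosure ℚ) →
    (∀ g ∈ G.points (AlgebraicClosure ℚ), ∀ u ∈ U.points (AlgebraicClosure ℚ),
      g * u * g⁻¹ ∈ U.points (AlgebraicClosure ℚ)) →
    (∀ u ∈ U.points (AlgebraicClosure ℚ), IsNilpotent (u.val - 1)) →
    U.points (AlgebraicClosure ℚ) = ⊥

/-- The complexified Lie algebra: the `X` with `1 + εX ∈ G(ℂ[ε])`. -/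
def LinAlgGroup.lieAlgebra (G : LinAlgGroup ℚ n) : Set (Matrix n n ℂ) :=
  {X | ∃ g ∈ G.points (DualNumber ℂ),
    g.val = 1 + X.map (TrivSqZeroExt.inr : ℂ → DualNumber ℂ)}

/-! ### Shimura data -/

/-- A homomorphism from the Deligne torus `𝕊 = Res_{ℂ/ℝ} 𝔾_m` to `𝒜_ℝ`: a natural family of
homomorphisms `(ℂ ⊗ R)ˣ → 𝒜(R)` over all commutative `ℝ`-algebras `R`. -/
@[ext]
structure DeligneHom (𝒜 : GroupFunctor) where
  app (R : Type) [CommRing R] [Algebra ℝ R] [Algebra ℚ R] : (ℂ ⊗[ℝ] R)ˣ →* 𝒜.obj R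
  naturality {R S : Type} [CommRing R] [Algebra ℝ R] [Algebra ℚ R] [CommRing S] [Algebra ℝ S]
    [Algebra ℚ S] (f : R →ₐ[ℝ] S) (z : (ℂ ⊗[ℝ] R)ˣ) :
    𝒜.map (f : R →+* S) (app R z) = app S
      (Units.map (Algebra.TensorProduct.map (AlgHom.id ℝ ℂ) f : ℂ ⊗[ℝ] R →* ℂ ⊗[ℝ] S) z)

/-- Conjugation of `h : 𝕊 → 𝒜_ℝ` by `g ∈ 𝒜(ℝ)`. -/
instance DeligneHom.instConjAction (𝒜 : GroupFunctor) : MulAction (𝒜.obj ℝ) (DeligneHom 𝒜) where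
  smul g h :=
    { app := fun R _ _ _ =>
        (MulAut.conj (𝒜.map (algebraMap ℝ R) g)).toMonoidHom.comp (h.app R)
      naturality := fun {R S} _ _ _ _ _ _ f z => by
        have e : 𝒜.map (f : R →+* S) (𝒜.map (algebraMap ℝ R) g) = 𝒜.map (algebraMap ℝ S) g := by
          rw [← 𝒜.map_comp]
          exact congrArg (fun r => 𝒜.map r g) (AlgHom.comp_algebraMap f)
        simp [h.naturality f z, e] }
  one_smul h := by
    refine DeligneHom.ext ?_
    funext R _ _ _
    ext z
    change 𝒜.map _ 1 * h.app R z * (𝒜.map _ 1)⁻¹ = _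
    simp
  mul_smul g g' h := by
    refine DeligneHom.ext ?_
    funext R _ _ _
    ext z
    change 𝒜.map _ (g * g') * h.app R z * (𝒜.map _ (g * g'))⁻¹ =
      𝒜.map _ g * (𝒜.map _ g' * h.app R z * (𝒜.map _ g')⁻¹) * (𝒜.map _ g)⁻¹
    simp [mul_assoc]

/-- Composition of `h : 𝕊 → 𝒜_ℝ` with a homomorphism `𝒜 → ℬ`. -/
def DeligneHom.comp {𝒜 ℬ : GroupFunctor} (h : DeligneHom 𝒜) (α : 𝒜.Hom ℬ) : DeligneHom ℬ where
  app R _ _ _ := (α.app R).comp (h.app R)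
  naturality f z := by
    simp only [MonoidHom.comp_apply]
    rw [α.naturality, h.naturality f z]

theorem DeligneHom.smul_comp {𝒜 ℬ : GroupFunctor} (h : DeligneHom 𝒜) (α : 𝒜.Hom ℬ)
    (g : 𝒜.obj ℝ) : (g • h).comp α = α.app ℝ g • h.comp α := by
  refine DeligneHom.ext ?_
  funext R _ _ _
  ext z
  change α.app R (𝒜.map _ g * h.app R z * (𝒜.map _ g)⁻¹) =
    ℬ.map _ (α.app ℝ g) * α.app R (h.app R z) * (ℬ.map _ (α.app ℝ g))⁻¹
  rw [α.naturality]
  simp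

/-- The value `h(z)` of `h : 𝕊 → 𝒜_ℝ` at `z ∈ ℂˣ = 𝕊(ℝ)`. -/
def DeligneHom.at {𝒜 : GroupFunctor} (h : DeligneHom 𝒜) (z : ℂˣ) : 𝒜.obj ℝ :=
  h.app ℝ (Units.map (Algebra.TensorProduct.includeLeft : ℂ →ₐ[ℝ] ℂ ⊗[ℝ] ℝ) z)

/-- The imaginary unit in `ℂˣ`. -/
def unitI : ℂˣ := Units.mk0 Complex.I Complex.I_ne_zero

/-- `X` is a `G(ℝ)`-conjugacy class of homomorphisms `𝕊 → G_ℝ` such that `(G, X)` satisfies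
Deligne's axioms of a Shimura datum. -/
structure IsShimuraDatum (G : LinAlgGroup ℚ n) (X : Set (DeligneHom (GLFunctor n))) : Prop where
  reductive : G.IsConnectedReductive
  /-- every `h ∈ X` has values in `G_ℝ` -/
  mem : ∀ h ∈ X, ∀ (R : Type) [CommRing R] [Algebra ℝ R] [Algebra ℚ R] (z : (ℂ ⊗[ℝ] R)ˣ),
    h.app R z ∈ G.functor.obj R
  /-- `X` is a single `G(ℝ)`-conjugacy class -/
  conjClass : ∃ h₀, X = {h | ∃ g ∈ G.functor.obj ℝ, h = g • h₀}
  /-- SV1: only the characters `z/z̄`, `1`, `z̄/z` of `𝕊` occur in `Lie(G)_ℂ` -/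
  sv1 : ∀ h ∈ X, ∀ L ∈ G.lieAlgebra, ∃ A ∈ G.lieAlgebra, ∃ B ∈ G.lieAlgebra,
    ∃ C ∈ G.lieAlgebra, L = A + B + C ∧ ∀ z : ℂˣ,
      let c : GL n ℂ := (GLFunctor n).map (algebraMap ℝ ℂ) (h.at z)
      c.val * A * (c⁻¹).val = ((z : ℂ) / starRingEnd ℂ z) • A ∧
      c.val * B * (c⁻¹).val = B ∧
      c.val * C * (c⁻¹).val = (starRingEnd ℂ z / (z : ℂ)) • C
  /-- SV2: `ad h(i)` is a Cartan involution of `G^ad_ℝ`, i.e. the real form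
  `{g ∈ G^ad(ℂ) : h(i) ḡ h(i)⁻¹ = g}` of `G^ad(ℂ) = G(ℂ) / Z(G(ℂ))` is compact -/
  sv2 : ∀ h ∈ X, IsCompact {q : G.points ℂ ⧸ Subgroup.center (G.points ℂ) |
    ∃ g g' : G.points ℂ, q = QuotientGroup.mk g ∧ q = QuotientGroup.mk g' ∧
      g'.val = (GLFunctor n).map (algebraMap ℝ ℂ) (h.at unitI) *
        (GLFunctor n).map (starRingEnd ℂ) g.val *
        ((GLFunctor n).map (algebraMap ℝ ℂ) (h.at unitI))⁻¹}
  /-- SV3: `G^ad` has no nontrivial `ℚ`-factor on which the projection of `h` is trivial, i.e.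
  a normal `ℚ`-subgroup containing the center through which `h` factors is all of `G` -/
  sv3 : ∀ h ∈ X, ∀ M : LinAlgGroup ℚ n,
    (∀ (R : Type) [CommRing R] [Algebra ℚ R], M.points R ≤ G.points R) →
    (∀ (R : Type) [CommRing R] [Algebra ℚ R], ∀ g ∈ G.points R, ∀ m ∈ M.points R,
      g * m * g⁻¹ ∈ M.points R) →
    (∀ (R : Type) [CommRing R] [Algebra ℚ R] (z : GL n R), G.InCenter z → z ∈ M.points R) →
    (∀ (R : Type) [CommRing R] [Algebra ℝ R] [Algebra ℚ R] (z : (ℂ ⊗[ℝ] R)ˣ),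
      h.app R z ∈ M.functor.obj R) →
    ∀ (R : Type) [CommRing R] [Algebra ℚ R], M.points R = G.points R

/-- `g ∈ GL_n(S)` is a symplectic similitude with multiplier `c` of the form with matrix `ψ`. -/
def IsSimilitude (ψ : Matrix n n ℚ) {S : Type} [CommRing S] [Algebra ℚ S] (g : GL n S)
    (c : S) : Prop :=
  g.valᵀ * ψ.map (algebraMap ℚ S) * g.val = c • ψ.map (algebraMap ℚ S)

/-- `(G, X)` is of Hodge type, embedded in the Siegel Shimura datum of the symplectic space
`(ℚⁿ, ψ)`: `ψ` is a symplectic form, `G ⊆ GSp(ψ)`, and every `h ∈ X` lies in the double Siegel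
half space, i.e. it is a Hodge structure of type `{(-1,0),(0,-1)}` on `ℝⁿ` (equivalently
`h(a + bi) = a + b h(i)`) for which `ψ(x, h(i) y)` is a definite form. -/
structure IsHodgeEmbedding (ψ : Matrix n n ℚ) (G : LinAlgGroup ℚ n)
    (X : Set (DeligneHom (GLFunctor n))) : Prop where
  alternating : ψᵀ = -ψ
  nondegenerate : ψ.det ≠ 0
  le_GSp : ∀ (R : Type) [CommRing R] [Algebra ℚ R], ∀ g ∈ G.points R,
    ∃ c : Rˣ, IsSimilitude ψ g (c : R)
  hodgeType : ∀ h ∈ X, ∀ z : ℂˣ, (h.at z : GL n ℝ).val =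
    (z : ℂ).re • (1 : Matrix n n ℝ) + (z : ℂ).im • (h.at unitI : GL n ℝ).val
  definite : ∀ h ∈ X,
    (∀ x : n → ℝ, x ≠ 0 →
      0 < x ⬝ᵥ (ψ.map (algebraMap ℚ ℝ) *ᵥ ((h.at unitI : GL n ℝ).val *ᵥ x))) ∨
    (∀ x : n → ℝ, x ≠ 0 →
      x ⬝ᵥ (ψ.map (algebraMap ℚ ℝ) *ᵥ ((h.at unitI : GL n ℝ).val *ᵥ x)) < 0)

/-! ### The groups `H` and `H₁` and the spaces `Y` and `Y₁` -/

/-- `H = Res_{F/ℚ} G_F`. -/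
def groupH (G : LinAlgGroup ℚ n) (F : Type) [Field F] [Algebra ℚ F] :
    GalSubgroup F (GLFunctor n) :=
  G.functor.weilRes F

theorem IsSimilitude.one (ψ : Matrix n n ℚ) (S : Type) [CommRing S] [Algebra ℚ S] :
    IsSimilitude ψ (1 : GL n S) 1 := by simp [IsSimilitude]

theorem IsSimilitude.mul {ψ : Matrix n n ℚ} {S : Type} [CommRing S] [Algebra ℚ S] {g h : GL n S}
    {c d : S} (hg : IsSimilitude ψ g c) (hh : IsSimilitude ψ h d) :
    IsSimilitude ψ (g * h) (c * d) := by
  unfold IsSimilitude at *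
  calc (g * h).valᵀ * ψ.map (algebraMap ℚ S) * (g * h).val
      = h.valᵀ * (g.valᵀ * ψ.map (algebraMap ℚ S) * g.val) * h.val := by
        simp [Matrix.transpose_mul, Matrix.mul_assoc]
    _ = (c * d) • ψ.map (algebraMap ℚ S) := by
        rw [hg, Matrix.mul_smul, Matrix.smul_mul, hh, smul_smul]

theorem IsSimilitude.inv {ψ : Matrix n n ℚ} {S : Type} [CommRing S] [Algebra ℚ S] {g : GL n S}
    {c d : S} (hg : IsSimilitude ψ g c) (hd : d * c = 1) : IsSimilitude ψ g⁻¹ d := by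
  unfold IsSimilitude at *
  have e : g.val * (g⁻¹).val = 1 := g.mul_inv
  have e' : (g⁻¹).valᵀ * g.valᵀ = 1 := by rw [← Matrix.transpose_mul, e, Matrix.transpose_one]
  have : ψ.map (algebraMap ℚ S) = c • ((g⁻¹).valᵀ * ψ.map (algebraMap ℚ S) * (g⁻¹).val) := by
    calc ψ.map (algebraMap ℚ S)
        = ((g⁻¹).valᵀ * g.valᵀ) * ψ.map (algebraMap ℚ S) * (g.val * (g⁻¹).val) := by
          rw [e, e', Matrix.one_mul, Matrix.mul_one]
      _ = (g⁻¹).valᵀ * (g.valᵀ * ψ.map (algebraMap ℚ S) * g.val) * (g⁻¹).val := by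
          simp only [Matrix.mul_assoc]
      _ = _ := by rw [hg, Matrix.mul_smul, Matrix.smul_mul]
  conv_rhs => rw [this, smul_smul, hd, one_smul]

theorem IsSimilitude.map {ψ : Matrix n n ℚ} {S T : Type} [CommRing S] [Algebra ℚ S] [CommRing T]
    [Algebra ℚ T] (f : S →+* T) {g : GL n S} {c : S} (hg : IsSimilitude ψ g c) :
    IsSimilitude ψ ((GLFunctor n).map f g) (f c) := by
  unfold IsSimilitude at *
  have h := congrArg (fun M : Matrix n n S => M.map f) hg
  have e : (ψ.map (algebraMap ℚ S)).map f = ψ.map (algebraMap ℚ T) := by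
    ext i j
    simp
  simp only [Matrix.map_mul, e] at h
  have e2 : (c • ψ.map (algebraMap ℚ S)).map f = f c • ψ.map (algebraMap ℚ T) := by
    ext i j
    simp
  rw [e2] at h
  exact h

/-- `H₃`, the fibre product of the similitude character `H → Res_{F/ℚ} 𝔾_m` with
`𝔾_m → Res_{F/ℚ} 𝔾_m`: the `h ∈ H(R)` whose multiplier in `(R ⊗ F)ˣ` lies in `Rˣ`. -/
def groupH3 (ψ : Matrix n n ℚ) (G : LinAlgGroup ℚ n) (F : Type) [Field F] [Algebra ℚ F] :
    GalSubgroup F (GLFunctor n) where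
  obj R _ _ :=
    { carrier := {g | g ∈ (groupH G F).obj R ∧ ∃ r : Rˣ, IsSimilitude ψ (S := R ⊗[ℚ] F) g
        ((r : R) ⊗ₜ[ℚ] (1 : F))}
      one_mem' := ⟨one_mem _, 1, IsSimilitude.one ψ (R ⊗[ℚ] F)⟩
      mul_mem' := by
        rintro a b ⟨ha, r, hr⟩ ⟨hb, s, hs⟩
        refine ⟨mul_mem ha hb, r * s, ?_⟩
        have := IsSimilitude.mul (S := R ⊗[ℚ] F) hr hs
        rw [Algebra.TensorProduct.tmul_mul_tmul, mul_one] at this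
        exact this
      inv_mem' := by
        rintro a ⟨ha, r, hr⟩
        refine ⟨inv_mem ha, r⁻¹, IsSimilitude.inv (S := R ⊗[ℚ] F) hr ?_⟩
        rw [Algebra.TensorProduct.tmul_mul_tmul, mul_one, Units.inv_mul]
        rfl }
  map_mem {R S} _ _ _ _ f g := by
    rintro ⟨hg, r, hr⟩
    refine ⟨(groupH G F).map_mem f hg, Units.map f.toMonoidHom r, ?_⟩
    have := IsSimilitude.map (baseMap F f) hr
    have e : baseMap F f ((r : R) ⊗ₜ[ℚ] (1 : F)) =
        ((Units.map f.toMonoidHom r : Sˣ) : S) ⊗ₜ[ℚ] (1 : F) := by simp [baseMap]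
    rw [e] at this
    exact this
  gal_mem γ R _ _ g := by
    rintro ⟨hg, r, hr⟩
    refine ⟨(groupH G F).gal_mem γ hg, r, ?_⟩
    have := IsSimilitude.map (galMap γ R) hr
    have e : galMap γ R ((r : R) ⊗ₜ[ℚ] (1 : F)) = (r : R) ⊗ₜ[ℚ] (1 : F) := by simp [galMap]
    rw [e] at this
    exact this

/-- `H₁`, the neutral component of `H₃`. -/
def groupH1 (ψ : Matrix n n ℚ) (G : LinAlgGroup ℚ n) (F : Type) [Field F] [Algebra ℚ F] :
    GalSubgroup F (GLFunctor n) :=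
  (groupH3 ψ G F).neutralComponent

theorem groupH1_le (ψ : Matrix n n ℚ) (G : LinAlgGroup ℚ n) (F : Type) [Field F] [Algebra ℚ F]
    (R : Type) [CommRing R] [Algebra ℚ R] : (groupH1 ψ G F).obj R ≤ (groupH G F).obj R :=
  fun _ hg => hg.1.1

section spaceY

variable {𝒜 : GroupFunctor} {F : Type} [Field F] [Algebra ℚ F]

/-- The `P(ℝ)`-conjugacy class of the composites `𝕊 → G_ℝ → (Res_{F/ℚ} G_F)_ℝ` of the `h ∈ X`, for
`P = H` or `P = H₁`. As `P → Res_{F/ℚ} GL_n` is a monomorphism, homomorphisms into `P_ℝ` are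
regarded as homomorphisms into `(Res_{F/ℚ} GL_n)_ℝ`. (The class does not depend on `h ∈ X`.) -/
def spaceY (P : GalSubgroup F 𝒜) (X : Set (DeligneHom 𝒜)) : Set (DeligneHom (𝒜.weilRes F)) :=
  {y | ∃ h ∈ X, ∃ g ∈ P.obj ℝ, y = g • h.comp (𝒜.toWeilRes F)}

/-- `P(ℚ)` acts on the conjugacy class through conjugation by `P(ℝ)`. -/
instance (P : GalSubgroup F 𝒜) (X : Set (DeligneHom 𝒜)) :
    MulAction (P.obj ℚ) (spaceY P X) where
  smul g y := ⟨(P.map (algebraMap ℚ ℝ) g).1 • y.1, by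
    obtain ⟨h, hh, p, hp, e⟩ := y.2
    exact ⟨h, hh, (P.map (algebraMap ℚ ℝ) g).1 * p, mul_mem (P.map _ g).2 hp, by
      rw [e, mul_smul]⟩⟩
  one_smul y := Subtype.ext (by
    change (P.map (algebraMap ℚ ℝ) 1).1 • y.1 = y.1
    rw [map_one]
    exact one_smul _ _)
  mul_smul g g' y := Subtype.ext (by
    change (P.map (algebraMap ℚ ℝ) (g * g')).1 • y.1 = _ • _ • y.1
    rw [map_mul]
    exact mul_smul _ _ _)

theorem DeligneHom.comp_gal_toWeilRes (h : DeligneHom 𝒜) (γ : F ≃ₐ[ℚ] F) :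
    (h.comp (𝒜.toWeilRes F)).comp (𝒜.gal γ) = h.comp (𝒜.toWeilRes F) := by
  refine DeligneHom.ext ?_
  funext R _ _ _
  ext z
  exact 𝒜.gal_toWeilRes γ R (h.app R z)

/-- `Gal(F/ℚ)` acts on the conjugacy class by composition. -/
instance (P : GalSubgroup F 𝒜) (X : Set (DeligneHom 𝒜)) :
    MulAction (F ≃ₐ[ℚ] F) (spaceY P X) where
  smul γ y := ⟨y.1.comp (𝒜.gal γ), by
    obtain ⟨h, hh, p, hp, e⟩ := y.2
    exact ⟨h, hh, (𝒜.gal γ).app ℝ p, P.gal_mem γ hp, by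
      rw [e, DeligneHom.smul_comp, DeligneHom.comp_gal_toWeilRes]⟩⟩
  one_smul y := Subtype.ext (by
    refine DeligneHom.ext ?_
    funext R _ _ _
    ext z
    exact 𝒜.gal_one R _)
  mul_smul γ δ y := Subtype.ext (by
    refine DeligneHom.ext ?_
    funext R _ _ _
    ext z
    exact 𝒜.gal_mul γ δ R _)

theorem spaceY_smul_smul (P : GalSubgroup F 𝒜) (X : Set (DeligneHom 𝒜)) (γ : F ≃ₐ[ℚ] F)
    (g : P.obj ℚ) (y : spaceY P X) : γ • (g • y) = (γ • g) • (γ • y) := by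
  refine Subtype.ext ?_
  change ((P.map (algebraMap ℚ ℝ) g).1 • y.1).comp (𝒜.gal γ) =
    (P.map (algebraMap ℚ ℝ) (γ • g)).1 • y.1.comp (𝒜.gal γ)
  rw [DeligneHom.smul_comp, P.map_smul]
  rfl

end spaceY

/-! ### Adeles, level subgroups -/

/-- The place of `ℚ` given by a prime number. -/
def place (ℓ : Nat.Primes) : HeightOneSpectrum ℤ := Rat.HeightOneSpectrum.primesEquiv.symm ℓ

/-- The ring of finite adeles `𝔸_f` of `ℚ`. -/
abbrev Af : Type := FiniteAdeleRing ℤ ℚ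

/-- The completion `ℚ_v`; `ℚ_ℓ` is `Qv (place ℓ)`. -/
def Qv (v : HeightOneSpectrum ℤ) : Type := v.adicCompletion ℚ

instance (v : HeightOneSpectrum ℤ) : Field (Qv v) := inferInstanceAs (Field (v.adicCompletion ℚ))

instance (v : HeightOneSpectrum ℤ) : TopologicalSpace (Qv v) :=
  inferInstanceAs (TopologicalSpace (v.adicCompletion ℚ))

instance (v : HeightOneSpectrum ℤ) : Algebra ℚ (Qv v) :=
  inferInstanceAs (Algebra ℚ (v.adicCompletion ℚ))

/-- The ring `𝔸_f^v` of finite adeles of `ℚ` away from the place `v`. -/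
def AfAway (v : HeightOneSpectrum ℤ) : Type :=
  Πʳ w : {w : HeightOneSpectrum ℤ // w ≠ v},
    [w.1.adicCompletion ℚ, w.1.adicCompletionIntegers ℚ]

instance (v : HeightOneSpectrum ℤ) : CommRing (AfAway v) :=
  inferInstanceAs (CommRing (Πʳ w : {w : HeightOneSpectrum ℤ // w ≠ v},
    [w.1.adicCompletion ℚ, w.1.adicCompletionIntegers ℚ]))

instance (v : HeightOneSpectrum ℤ) : TopologicalSpace (AfAway v) :=
  inferInstanceAs (TopologicalSpace (Πʳ w : {w : HeightOneSpectrum ℤ // w ≠ v},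
    [w.1.adicCompletion ℚ, w.1.adicCompletionIntegers ℚ]))

/-- The projection `𝔸_f → ℚ_v`. -/
def Af.toQv (v : HeightOneSpectrum ℤ) : Af →+* Qv v :=
  RestrictedProduct.evalRingHom (fun w : HeightOneSpectrum ℤ => w.adicCompletion ℚ) v

/-- The projection `𝔸_f → 𝔸_f^v`. -/
def Af.toAway (v : HeightOneSpectrum ℤ) : Af →+* AfAway v :=
  RestrictedProduct.mapAlongRingHom
    (fun w : HeightOneSpectrum ℤ => w.adicCompletion ℚ)
    (fun w : {w : HeightOneSpectrum ℤ // w ≠ v} => w.1.adicCompletion ℚ)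
    Subtype.val Subtype.val_injective.tendsto_cofinite (fun _ => RingHom.id _)
    (Filter.Eventually.of_forall fun _ _ hx => hx)

instance (v : HeightOneSpectrum ℤ) : Algebra ℚ (AfAway v) :=
  ((Af.toAway v).comp (algebraMap ℚ Af)).toAlgebra

/-- The projection `𝔸_f^v → ℚ_w` for `w ≠ v`. -/
def AfAway.toQv {v : HeightOneSpectrum ℤ} (w : {w : HeightOneSpectrum ℤ // w ≠ v}) :
    AfAway v →+* Qv w.1 :=
  RestrictedProduct.evalRingHom
    (fun w : {w : HeightOneSpectrum ℤ // w ≠ v} => w.1.adicCompletion ℚ) w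

/-- For a topological `ℚ`-algebra `R`, the topology of `GL_n(R ⊗ F)` as the unit group of the matrix
ring over the finite free `R`-algebra `R ⊗ F` (with its canonical topology as an `R`-module).
Subgroups such as `H(R)` carry the subspace topology. -/
instance (F : Type) [Field F] [Algebra ℚ F] (R : Type) [CommRing R] [Algebra ℚ R]
    [TopologicalSpace R] : TopologicalSpace (((GLFunctor n).weilRes F).obj R) :=
  letI : TopologicalSpace (R ⊗[ℚ] F) := moduleTopology R (R ⊗[ℚ] F)
  inferInstanceAs (TopologicalSpace (Matrix n n (R ⊗[ℚ] F))ˣ)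

/-- The subgroup of `K̄ˣ` generated by the eigenvalues of `g ∈ GL_n(K ⊗ F)` acting on the
`K`-vector space `(K ⊗ F)ⁿ`. -/
def eigenvalueGroup {F : Type} [Field F] [NumberField F] {K : Type} [Field K] [Algebra ℚ K]
    (g : GL n (K ⊗[ℚ] F)) : Subgroup (AlgebraicClosure K)ˣ :=
  Subgroup.closure {u | Polynomial.aeval (u : AlgebraicClosure K)
    (LinearMap.charpoly ((Matrix.toLin' g.val).restrictScalars K)) = 0}

section levels

variable {F : Type} [Field F] [NumberField F]

/-- An element `g = (g_w)` of `H(𝔸_f^v)` is neat if the intersection over all `w ≠ v` of the torsion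
subgroups of the groups generated by the eigenvalues of `g_w` is trivial, i.e. if no order `m > 1`
of a root of unity occurs in these groups for all `w ≠ v` at once. (The `m`-th roots of unity in
such a group are all the `m`-th roots of unity as soon as one of them is primitive, so the
intersection does not depend on embeddings of `ℚ̄` in `ℚ̄_w`.) A subgroup is neat if
its elements are. -/
def IsNeat {v : HeightOneSpectrum ℤ} {P : GalSubgroup F (GLFunctor n)}
    (K : Subgroup (P.obj (AfAway v))) : Prop :=
  ∀ g ∈ K, ∀ m : ℕ, 1 < m → ∃ w : {w : HeightOneSpectrum ℤ // w ≠ v},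
    ∀ ζ ∈ eigenvalueGroup (n := n) (F := F) (K := Qv w.1) (P.map (AfAway.toQv w) g).1,
      orderOf ζ ≠ m

/-- Stability under `Γ` of a subgroup. -/
def IsStable (Γ : Type) [Group Γ] {T : Type} [Group T] [MulDistribMulAction Γ T]
    (K : Subgroup T) : Prop :=
  ∀ γ : Γ, ∀ g ∈ K, γ • g ∈ K

/-- The nonabelian cohomology `H¹(Γ, K)` is trivial: every `1`-cocycle is a coboundary. -/
def TrivialH1 (Γ : Type) [Group Γ] {T : Type} [Group T] [MulDistribMulAction Γ T]
    (K : Subgroup T) : Prop :=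
  ∀ σ : Γ → T, (∀ γ, σ γ ∈ K) → (∀ γ δ, σ (γ * δ) = σ γ * γ • σ δ) →
    ∃ k ∈ K, ∀ γ, σ γ = k⁻¹ * γ • k

/-- A good compact open subgroup: compact, open, `Γ`-stable, with trivial `H¹(Γ, K)`. -/
structure IsGoodCompactOpen (Γ : Type) [Group Γ] {T : Type} [Group T] [TopologicalSpace T]
    [MulDistribMulAction Γ T] (K : Subgroup T) : Prop where
  isCompact : IsCompact (K : Set T)
  isOpen : IsOpen (K : Set T)
  stable : IsStable Γ K
  trivialH1 : TrivialH1 Γ K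

/-- A pro-`ℓ` subgroup of a Hausdorff, totally disconnected topological group: it is compact (hence
profinite), and its open normal subgroups have `ℓ`-power index. -/
def IsProSubgroup (ℓ : ℕ) {T : Type} [Group T] [TopologicalSpace T] (K : Subgroup T) : Prop :=
  IsCompact (K : Set T) ∧
    ∀ N : Subgroup K, N.Normal → IsOpen (N : Set K) → ∃ k : ℕ, N.index = ℓ ^ k

/-- For `P ⊆ Q`, the inclusion `P(R) → Q(R)`. -/
def incl {P Q : GalSubgroup F (GLFunctor n)}
    (hPQ : ∀ (R : Type) [CommRing R] [Algebra ℚ R], P.obj R ≤ Q.obj R)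
    (R : Type) [CommRing R] [Algebra ℚ R] : P.obj R →* Q.obj R :=
  Subgroup.inclusion (hPQ R)

theorem comap_stable {P Q : GalSubgroup F (GLFunctor n)}
    (hPQ : ∀ (R : Type) [CommRing R] [Algebra ℚ R], P.obj R ≤ Q.obj R) {R S : Type} [CommRing R]
    [Algebra ℚ R] [CommRing S] [Algebra ℚ S] (f : R →+* S) {K : Subgroup (Q.obj S)}
    (h : IsStable (F ≃ₐ[ℚ] F) K) :
    IsStable (F ≃ₐ[ℚ] F) (K.comap ((incl hPQ S).comp (P.map f))) := by
  intro γ g hg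
  have e : incl hPQ S (P.map f (γ • g)) = γ • incl hPQ S (P.map f g) := by
    rw [P.map_smul]
    rfl
  change incl hPQ S (P.map f (γ • g)) ∈ K
  rw [e]
  exact h γ _ hg

theorem IsStable.inf {Γ : Type} [Group Γ] {T : Type} [Group T] [MulDistribMulAction Γ T]
    {K L : Subgroup T} (hK : IsStable Γ K) (hL : IsStable Γ L) : IsStable Γ (K ⊓ L) :=
  fun γ g hg => ⟨hK γ g hg.1, hL γ g hg.2⟩

/-- For `P ⊆ Q` and subgroups `Kaway ⊆ Q(𝔸_f^v)` and `Kat ⊆ Q(ℚ_v)`, the subgroup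
`(Kaway ∩ P(𝔸_f^v)) (Kat ∩ P(ℚ_v))` of `P(𝔸_f) = P(𝔸_f^v) × P(ℚ_v)`. -/
def level {v : HeightOneSpectrum ℤ} {P Q : GalSubgroup F (GLFunctor n)}
    (hPQ : ∀ (R : Type) [CommRing R] [Algebra ℚ R], P.obj R ≤ Q.obj R)
    (Kaway : Subgroup (Q.obj (AfAway v))) (Kat : Subgroup (Q.obj (Qv v))) :
    Subgroup (P.obj Af) :=
  Kaway.comap ((incl hPQ (AfAway v)).comp (P.map (Af.toAway v))) ⊓
    Kat.comap ((incl hPQ (Qv v)).comp (P.map (Af.toQv v)))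

theorem level_stable {v : HeightOneSpectrum ℤ} {P Q : GalSubgroup F (GLFunctor n)}
    (hPQ : ∀ (R : Type) [CommRing R] [Algebra ℚ R], P.obj R ≤ Q.obj R)
    {Kaway : Subgroup (Q.obj (AfAway v))} {Kat : Subgroup (Q.obj (Qv v))}
    (h1 : IsStable (F ≃ₐ[ℚ] F) Kaway) (h2 : IsStable (F ≃ₐ[ℚ] F) Kat) :
    IsStable (F ≃ₐ[ℚ] F) (level hPQ Kaway Kat) :=
  (comap_stable hPQ (Af.toAway v) h1).inf (comap_stable hPQ (Af.toQv v) h2)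

theorem level_le {v : HeightOneSpectrum ℤ} {P Q : GalSubgroup F (GLFunctor n)}
    (hPQ : ∀ (R : Type) [CommRing R] [Algebra ℚ R], P.obj R ≤ Q.obj R)
    (Kaway : Subgroup (Q.obj (AfAway v))) (Kat : Subgroup (Q.obj (Qv v))) :
    level hPQ Kaway Kat ≤
      (level (P := Q) (fun _ _ _ => le_rfl) Kaway Kat).comap (incl hPQ Af) :=
  fun _ hg => hg

/-- For `P ⊆ Q` and `K_v ⊆ Q(ℚ_v)`, the subgroup `K_v ∩ P(ℚ_v)` of `Q(ℚ_v)`. -/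
def interSubgroup (P : GalSubgroup F (GLFunctor n)) {Q : GalSubgroup F (GLFunctor n)}
    {R : Type} [CommRing R] [Algebra ℚ R] (K : Subgroup (Q.obj R)) : Subgroup (Q.obj R) :=
  K ⊓ (P.obj R).subgroupOf (Q.obj R)

theorem interSubgroup_stable (P : GalSubgroup F (GLFunctor n))
    {Q : GalSubgroup F (GLFunctor n)} {R : Type} [CommRing R] [Algebra ℚ R]
    {K : Subgroup (Q.obj R)} (h : IsStable (F ≃ₐ[ℚ] F) K) :
    IsStable (F ≃ₐ[ℚ] F) (interSubgroup P K) :=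
  fun γ g hg => ⟨h γ g hg.1, P.gal_mem γ hg.2⟩

end levels

/-! ### Action groupoids with `Γ`-action and homotopy fixed points -/

/-- A group `A` acting on a set `X`, together with compatible actions of `Γ` on `A` (by group
automorphisms) and on `X`. The action groupoid `[A \ X]` has the objects `x ∈ X` and the morphisms
`x ⟶ x'` given by the `a ∈ A` with `a x = x'`; each `γ ∈ Γ` acts on it by the functor
`x ↦ γ x`, `a ↦ γ a`. -/
structure SemilinearAction (Γ : Type) [Group Γ] where
  A : Type
  X : Type 1
  [group : Group A]
  [action : MulAction A X]
  [galA : MulDistribMulAction Γ A]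
  [galX : MulAction Γ X]
  smul_smul' (γ : Γ) (a : A) (x : X) : γ • (a • x) = (γ • a) • (γ • x)

attribute [instance] SemilinearAction.group SemilinearAction.action SemilinearAction.galA
  SemilinearAction.galX

section homotopyFixedPoints

variable {Γ : Type} [Group Γ]

/-- The objects of the `Γ`-homotopy fixed points `[A \ X]^{hΓ}`: an object `x` of `[A \ X]` with
isomorphisms `τ_γ : x ⟶ γ x` such that `γ'(τ_γ) ∘ τ_γ' = τ_{γ'γ}`. -/
structure HFixed (S : SemilinearAction Γ) where
  pt : S.X
  τ : Γ → S.A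
  τ_smul (γ : Γ) : τ γ • pt = γ • pt
  cocycle (γ' γ : Γ) : (γ' • τ γ) * τ γ' = τ (γ' * γ)

/-- The morphisms of `[A \ X]^{hΓ}`: morphisms `a : x ⟶ x'` of `[A \ X]` with
`γ(a) ∘ τ_γ = τ'_γ ∘ a`. -/
@[ext]
structure HFixed.Hom {S : SemilinearAction Γ} (x y : HFixed S) where
  val : S.A
  smul_pt : val • x.pt = y.pt
  comm (γ : Γ) : (γ • val) * x.τ γ = y.τ γ * val

instance (S : SemilinearAction Γ) : Category (HFixed S) where
  Hom x y := HFixed.Hom x y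
  id x := ⟨1, one_smul _ _, fun γ => by rw [smul_one, one_mul, mul_one]⟩
  comp {x y z} f g := ⟨g.val * f.val, by rw [mul_smul, f.smul_pt, g.smul_pt], fun γ => by
    rw [smul_mul', mul_assoc, f.comm, ← mul_assoc, g.comm, mul_assoc]⟩
  id_comp f := HFixed.Hom.ext (mul_one _)
  comp_id f := HFixed.Hom.ext (one_mul _)
  assoc f g h := HFixed.Hom.ext (mul_assoc _ _ _).symm

/-- The set `A \ X` of orbits. -/
abbrev SemilinearAction.Orbits (S : SemilinearAction Γ) : Type 1 :=
  MulAction.orbitRel.Quotient S.A S.X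

/-- The orbit of a point. -/
def SemilinearAction.orbit (S : SemilinearAction Γ) (x : S.X) : S.Orbits :=
  Quotient.mk (MulAction.orbitRel S.A S.X) x

/-- The action of `γ ∈ Γ` on the set of orbits. -/
def SemilinearAction.galOrbit (S : SemilinearAction Γ) (γ : Γ) : S.Orbits → S.Orbits :=
  Quotient.map (fun x => γ • x) (by
    rintro x y ⟨a, rfl⟩
    exact ⟨γ • a, (S.smul_smul' γ a y).symm⟩)

/-- The set `(A \ X)^Γ` of `Γ`-fixed points of the set of orbits. -/
def SemilinearAction.FixedOrbits (S : SemilinearAction Γ) : Type 1 :=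
  {o : S.Orbits // ∀ γ : Γ, S.galOrbit γ o = o}

/-- The functor `[A \ X]^{hΓ} ⥤ (A \ X)^Γ`, `(x, τ) ↦ A x`, to the set of `Γ`-fixed orbits,
regarded as a discrete category. -/
def SemilinearAction.toFixedOrbits (S : SemilinearAction Γ) :
    HFixed S ⥤ Discrete S.FixedOrbits where
  obj x := ⟨⟨S.orbit x.pt, fun γ => Quotient.sound ⟨x.τ γ, x.τ_smul γ⟩⟩⟩
  map {x y} f := Discrete.eqToHom (Subtype.ext (Quotient.sound
    (Setoid.symm' _ ⟨f.val, f.smul_pt⟩)))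

/-- A morphism of groups with semilinear actions. -/
structure SemilinearAction.Hom (S T : SemilinearAction Γ) where
  onA : S.A →* T.A
  onX : S.X → T.X
  map_smul (a : S.A) (x : S.X) : onX (a • x) = onA a • onX x
  galA (γ : Γ) (a : S.A) : onA (γ • a) = γ • onA a
  galX (γ : Γ) (x : S.X) : onX (γ • x) = γ • onX x

/-- The functor `[A \ X]^{hΓ} ⥤ [A' \ X']^{hΓ}` induced by the `Γ`-equivariant functor
`[A \ X] ⥤ [A' \ X']` coming from a morphism of semilinear actions. -/
def SemilinearAction.Hom.hFixed {S T : SemilinearAction Γ} (α : S.Hom T) :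
    HFixed S ⥤ HFixed T where
  obj x := ⟨α.onX x.pt, fun γ => α.onA (x.τ γ), fun γ => by
      rw [← α.map_smul, x.τ_smul, α.galX], fun γ' γ => by
      rw [← α.galA, ← map_mul, x.cocycle]⟩
  map {x y} f := ⟨α.onA f.val, by rw [← α.map_smul, f.smul_pt], fun γ => by
      rw [← α.galA, ← map_mul, f.comm, map_mul]⟩
  map_id x := HFixed.Hom.ext (map_one α.onA)
  map_comp f g := HFixed.Hom.ext (map_mul α.onA _ _)

end homotopyFixedPoints

/-! ### Shimura stacks -/

section shimura

variable {F : Type} [Field F] [NumberField F]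

/-- The action of `γ ∈ Gal(F/ℚ)` on `P(𝔸_f)/L` for a stable subgroup `L`. -/
def galQuotient {P : GalSubgroup F (GLFunctor n)} {L : Subgroup (P.obj Af)}
    (hL : IsStable (F ≃ₐ[ℚ] F) L) (γ : F ≃ₐ[ℚ] F) : P.obj Af ⧸ L → P.obj Af ⧸ L :=
  Quotient.map' (fun g => γ • g) (by
    intro a b h
    rw [QuotientGroup.leftRel_apply] at h ⊢
    rw [← smul_inv', ← smul_mul']
    exact hL γ _ h)

/-- `P(ℚ)` acting on `Y_P × P(𝔸_f)/L`, with its action of `Γ = Gal(F/ℚ)`. The corresponding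
action groupoid is the Shimura stack `[P(ℚ) \ Y_P × P(𝔸_f)/L]`. -/
def shimuraAction (P : GalSubgroup F (GLFunctor n)) (X : Set (DeligneHom (GLFunctor n)))
    (L : Subgroup (P.obj Af)) (hL : IsStable (F ≃ₐ[ℚ] F) L) :
    SemilinearAction (F ≃ₐ[ℚ] F) where
  A := P.obj ℚ
  X := spaceY P X × (P.obj Af ⧸ L)
  action :=
    { smul := fun g x => (g • x.1, P.map (algebraMap ℚ Af) g • x.2)
      one_smul := fun x => Prod.ext (one_smul _ _) (by
        change P.map (algebraMap ℚ Af) 1 • x.2 = x.2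
        rw [map_one, one_smul])
      mul_smul := fun g g' x => Prod.ext (mul_smul _ _ _) (by
        change P.map (algebraMap ℚ Af) (g * g') • x.2 =
          P.map (algebraMap ℚ Af) g • P.map (algebraMap ℚ Af) g' • x.2
        rw [map_mul, mul_smul]) }
  galX :=
    { smul := fun γ x => (γ • x.1, galQuotient hL γ x.2)
      one_smul := fun x => Prod.ext (one_smul _ _) (by
        obtain ⟨y, q⟩ := x
        induction q using QuotientGroup.induction_on with
        | H g => exact congrArg QuotientGroup.mk (one_smul _ g))
      mul_smul := fun γ δ x => Prod.ext (mul_smul _ _ _) (by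
        obtain ⟨y, q⟩ := x
        induction q using QuotientGroup.induction_on with
        | H g => exact congrArg QuotientGroup.mk (mul_smul γ δ g)) }
  smul_smul' γ a x := Prod.ext (spaceY_smul_smul P X γ a x.1) (by
    obtain ⟨y, q⟩ := x
    induction q using QuotientGroup.induction_on with
    | H g =>
      refine congrArg QuotientGroup.mk ?_
      change γ • (P.map (algebraMap ℚ Af) a * g) = P.map (algebraMap ℚ Af) (γ • a) * γ • g
      rw [smul_mul', P.map_smul])

/-- For `P ⊆ Q` and `L ⊆ L'`, the natural morphism from `P(ℚ)` acting on `Y_P × P(𝔸_f)/L` to `Q(ℚ)`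
acting on `Y_Q × Q(𝔸_f)/L'`. -/
def shimuraMap {P Q : GalSubgroup F (GLFunctor n)}
    (hPQ : ∀ (R : Type) [CommRing R] [Algebra ℚ R], P.obj R ≤ Q.obj R)
    (X : Set (DeligneHom (GLFunctor n))) {L : Subgroup (P.obj Af)} {L' : Subgroup (Q.obj Af)}
    (hL : IsStable (F ≃ₐ[ℚ] F) L) (hL' : IsStable (F ≃ₐ[ℚ] F) L')
    (hLL' : L ≤ L'.comap (incl hPQ Af)) :
    (shimuraAction P X L hL).Hom (shimuraAction Q X L' hL') where
  onA := incl hPQ ℚ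
  onX x := (⟨x.1.1, by
      obtain ⟨h, hh, p, hp, e⟩ := x.1.2
      exact ⟨h, hh, p, hPQ ℝ hp, e⟩⟩,
    Quotient.map' (incl hPQ Af) (fun a b h => by
      rw [QuotientGroup.leftRel_apply] at h ⊢
      rw [← map_inv, ← map_mul]
      exact hLL' h) x.2)
  map_smul a x := Prod.ext rfl (by
    obtain ⟨y, q⟩ := x
    induction q using QuotientGroup.induction_on with
    | H g => rfl)
  galA γ a := rfl
  galX γ x := Prod.ext rfl (by
    obtain ⟨y, q⟩ := x
    induction q using QuotientGroup.induction_on with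
    | H g => rfl)

end shimura

end PiatetskiShapiro

namespace PiatetskiShapiro

variable {n : Type} [Fintype n] [DecidableEq n]

/-! Two facts carry the theorem: $H_1(\mathbb{Q})$ acts freely on $Y_1\times H_1(\mathbb{A}_f)/L_1$,
where $L_1=K_1^\ell K_{1,\ell}$, and an element of $H(\mathbb{Q})$ that links two points coming from
$H_1$ already lies in $H_1(\mathbb{Q})$.

For a free action every equation between group elements can be tested on a single point. The
$\tau_\gamma$ attached to a fixed orbit are then unique and automatically form a cocycle, so
homotopy fixed points are just fixed orbits (`SemilinearAction.toFixedOrbits_isEquivalence`).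

Freeness is `shimuraAction_free`. Elements of a point stabilizer have bounded denominators, since
they lie in a conjugate of a compact group at the finite places. At each real place of $F$ they are,
after conjugation, similitudes of the definite form $\pm\psi(x,h(i)y)$. Their multiplier is rational
and positive, and it equals 1 because it and its inverse have powers with bounded denominators
(`one_le_multiplier`). They are therefore isometries, their entries are bounded at every embedding,
and only finitely many algebraic integers obey such bounds, so the stabilizer is finite
(`finite_of_stabilizer`). A nontrivial element of finite order has a power of prime order $p$, which
has an eigenvalue of order $p$ at every place; neatness forbids this
(`IsNeat.eq_one_of_isOfFinOrder`).

For the second fact, compare components at $\ell$, where the level is $K_{1,\ell}\subset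
H_1(\mathbb{Q}_\ell)$ on both sides. A linking element lies in $H(\mathbb{Q})\cap
H_1(\mathbb{Q}_\ell)$, and this is $H_1(\mathbb{Q})$ because both the multiplier condition and
membership in the neutral component descend along field extensions (`mem_groupH1_of_map`). With
injectivity on points this makes the functor on homotopy fixed points fully faithful
(`SemilinearAction.Hom.fullyFaithfulHFixed`). -/

/-! ### Homotopy fixed points of free actions -/

section freeActions

variable {Γ : Type} [Group Γ]

/-- For a free action, homotopy fixed points are the fixed points of the set of orbits. -/
theorem SemilinearAction.toFixedOrbits_isEquivalence (S : SemilinearAction Γ)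
    (hfree : ∀ (a : S.A) (x : S.X), a • x = x → a = 1) :
    S.toFixedOrbits.IsEquivalence := by
  -- Freeness as a cancellation rule: morphism and cocycle identities below are checked only after
  -- acting on one point.
  have hinj : ∀ (a b : S.A) (x : S.X), a • x = b • x → a = b := fun a b x h => by
    have := hfree (b⁻¹ * a) x (by rw [mul_smul, h, inv_smul_smul])
    rw [inv_mul_eq_one] at this
    exact this.symm
  refine { faithful := ⟨fun {x y} f g _ => HFixed.Hom.ext
              (hinj _ _ x.pt (f.smul_pt.trans g.smul_pt.symm))⟩,
           full := ⟨fun {x y} f => ?_⟩,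
           essSurj := ⟨fun o => ?_⟩ }
  · have ho : S.orbit x.pt = S.orbit y.pt := congrArg Subtype.val (Discrete.eq_of_hom f)
    obtain ⟨a, ha⟩ := Quotient.exact ho.symm
    refine ⟨⟨a, ha, fun γ => hinj _ _ x.pt ?_⟩, Subsingleton.elim _ _⟩
    rw [mul_smul, mul_smul, x.τ_smul, ← S.smul_smul']
    exact (congrArg (γ • ·) ha).trans ((y.τ_smul γ).symm.trans (congrArg (y.τ γ • ·) ha.symm))
  · obtain ⟨⟨o, ho⟩⟩ := o
    induction o using Quotient.inductionOn with
    | h x =>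
      -- The choices for different `γ` are independent; the cocycle condition holds anyway because
      -- each choice is unique.
      have hτ : ∀ γ : Γ, ∃ a : S.A, a • x = γ • x := fun γ => Quotient.exact (ho γ)
      choose τ hτ using hτ
      refine ⟨⟨x, τ, hτ, fun γ' γ => hinj _ _ x ?_⟩, ⟨eqToIso rfl⟩⟩
      rw [mul_smul, hτ, hτ, ← S.smul_smul', hτ, mul_smul]

/-- A morphism of semilinear actions that is injective on groups and sets, and for which every
group element linking points of the source comes from the source, induces a fully faithful
functor on homotopy fixed points. -/
def SemilinearAction.Hom.fullyFaithfulHFixed {S T : SemilinearAction Γ} (α : S.Hom T)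
    (hA : Function.Injective α.onA) (hX : Function.Injective α.onX)
    (hlink : ∀ (x y : S.X) (b : T.A), b • α.onX x = α.onX y → ∃ a, α.onA a = b) :
    α.hFixed.FullyFaithful where
  preimage {x y} f :=
    { val := (hlink x.pt y.pt f.val f.smul_pt).choose
      smul_pt := hX (by
        rw [α.map_smul, (hlink x.pt y.pt f.val f.smul_pt).choose_spec]
        exact f.smul_pt)
      comm := fun γ => hA (by
        rw [map_mul, map_mul, α.galA, (hlink x.pt y.pt f.val f.smul_pt).choose_spec]
        exact f.comm γ) }
  map_preimage {x y} f := HFixed.Hom.ext (hlink x.pt y.pt f.val f.smul_pt).choose_spec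
  preimage_map {x y} f := HFixed.Hom.ext
    (hA (hlink x.pt y.pt (α.onA f.val) (α.hFixed.map f).smul_pt).choose_spec)

end freeActions

/-- A functor out of a category equivalent to a discrete one descends to that discrete category,
and full faithfulness is inherited. -/
theorem exists_fullyFaithful_factorization {C : Type*} [Category C] {D : Type*} [Category D]
    {I : Type*} (E : C ⥤ Discrete I) (hE : E.IsEquivalence) (Ψ : C ⥤ D) (hΨ : Ψ.FullyFaithful) :
    ∃ Φ : Discrete I ⥤ D, Nonempty (E ⋙ Φ ≅ Ψ) ∧ Φ.Full ∧ Φ.Faithful ∧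
      ∀ a b, Nonempty (Φ.obj a ≅ Φ.obj b) → a = b := by
  have := hΨ.full
  have := hΨ.faithful
  refine ⟨E.inv ⋙ Ψ, ⟨(Functor.associator _ _ _).symm ≪≫
    Functor.isoWhiskerRight E.asEquivalence.unitIso.symm Ψ ≪≫ Ψ.leftUnitor⟩,
    inferInstance, inferInstance, fun a b ⟨e⟩ => ?_⟩
  have h := Discrete.eq_of_hom ((E.inv ⋙ Ψ).preimageIso e).hom
  exact Discrete.ext h

/-! ### Descent of points -/

/-- Restriction of regular functions along an extension of fields. -/
def RegFun.baseChange {𝒜 : GroupFunctor} (P : SubgroupFunctor 𝒜) {k K : Type} [Field k] [Field K]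
    (j : k →+* K) : RegFun P k →+* RegFun P K where
  toFun φ := ⟨fun A x =>
      letI : Algebra k A.carrier := ((algebraMap K A.carrier).comp j).toAlgebra
      φ.1 ⟨A.carrier⟩ x, fun A B f x => by
    let _ : Algebra k A.carrier := ((algebraMap K A.carrier).comp j).toAlgebra
    let _ : Algebra k B.carrier := ((algebraMap K B.carrier).comp j).toAlgebra
    exact φ.2 ⟨A.carrier⟩ ⟨B.carrier⟩
      { (f : A.carrier →+* B.carrier) with commutes' := fun r => f.commutes (j r) } x⟩
  map_one' := rfl
  map_mul' _ _ := rfl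
  map_zero' := rfl
  map_add' _ _ := rfl

/-- By naturality along `j`, the value of a function at the image of `x` is `j` of its value at `x`.
As `j` is injective, the same functions over `k` vanish at both points. -/
theorem RegFun.comap_baseChange_specPoint {𝒜 : GroupFunctor} (P : SubgroupFunctor 𝒜)
    {k K : Type} [Field k] [Algebra ℚ k] [Field K] [Algebra ℚ K] (j : k →+* K) (x : P.obj k) :
    PrimeSpectrum.comap (RegFun.baseChange P j) (specPoint P (P.map j x)) = specPoint P x := by
  refine PrimeSpectrum.ext (Ideal.ext fun φ => ?_)
  let _ : Algebra k K := j.toAlgebra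
  have h : φ.1 ⟨K⟩ (P.map j x) = j (φ.1 (AlgOver.self k) x) :=
    (φ.2 (AlgOver.self k) ⟨K⟩ (Algebra.ofId k K) x).symm
  change φ.1 ⟨K⟩ (P.map j x) ∈ (⊥ : Ideal K) ↔ φ.1 (AlgOver.self k) x ∈ (⊥ : Ideal k)
  rw [h]
  exact map_eq_zero j

/-- The continuous map of spectra given by restricting functions sends identity to identity, hence
component into component. This is the easy direction, so geometric connectedness plays no role. -/
theorem InIdentityComponent.of_map {𝒜 : GroupFunctor} (P : SubgroupFunctor 𝒜) {k K : Type}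
    [Field k] [Algebra ℚ k] [Field K] [Algebra ℚ K] (j : k →+* K) {x : P.obj k}
    (h : InIdentityComponent P (P.map j x)) : InIdentityComponent P x := by
  have := (PrimeSpectrum.continuous_comap (RegFun.baseChange P j)).image_connectedComponent_subset
    _ ⟨_, h, rfl⟩
  rw [RegFun.comap_baseChange_specPoint, ← map_one (P.map j),
    RegFun.comap_baseChange_specPoint] at this
  exact this

/-- Rational points lie in the neutral component if they do so over an extension field. -/
theorem GalSubgroup.mem_neutralComponent_of_map {F : Type} [Field F] [Algebra ℚ F]
    {𝒜 : GroupFunctor} (P : GalSubgroup F 𝒜) {K : Type} [Field K] [Algebra ℚ K]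
    {x : (𝒜.weilRes F).obj ℚ} (hx : x ∈ P.obj ℚ)
    (h : (𝒜.weilRes F).map (algebraMap ℚ K) x ∈ P.neutralComponent.obj K) :
    x ∈ P.neutralComponent.obj ℚ := by
  refine ⟨hx, fun k _ _ f => ?_⟩
  obtain ⟨hK, h⟩ := h
  -- A residue field of the nonzero ring `K ⊗ k` contains both fields: the hypothesis over `K`
  -- applies there, and the conclusion descends from there to `k`.
  obtain ⟨I, hI⟩ := Ideal.exists_maximal (K ⊗[ℚ] k)
  let _ : Field (K ⊗[ℚ] k ⧸ I) := Ideal.Quotient.field I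
  have h' := h (K ⊗[ℚ] k ⧸ I)
    ((Ideal.Quotient.mk I).comp Algebra.TensorProduct.includeLeftRingHom)
  refine InIdentityComponent.of_map P.toSubgroupFunctor
    ((Ideal.Quotient.mk I).comp (Algebra.TensorProduct.includeRight : k →ₐ[ℚ] K ⊗[ℚ] k).toRingHom)
    ?_
  have e : P.map (algebraMap ℚ K) ⟨x, hx⟩ = ⟨(𝒜.weilRes F).map (algebraMap ℚ K) x, hK⟩ := rfl
  rw [← e] at h'
  rw [P.map_map] at h' ⊢
  convert h' using 3
  exact Subsingleton.elim _ _

theorem baseMap_injective (K F : Type) [Field K] [Algebra ℚ K] [Field F] [Algebra ℚ F] :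
    Function.Injective (baseMap F (algebraMap ℚ K)) :=
  Module.Flat.rTensor_preserves_injective_linearMap (M := F)
    (algebraMap ℚ K).toRatAlgHom.toLinearMap (algebraMap ℚ K).injective

/-- An element of `ℚ ⊗ F` which becomes an element of `K ⊗ 1` in `K ⊗ F` is rational. -/
theorem exists_rat_of_baseMap_eq {K F : Type} [Field K] [Algebra ℚ K] [Field F] [Algebra ℚ F]
    (x : ℚ ⊗[ℚ] F) (r : K) (h : baseMap F (algebraMap ℚ K) x = r ⊗ₜ[ℚ] (1 : F)) :
    ∃ s : ℚ, x = s ⊗ₜ[ℚ] (1 : F) := by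
  -- A `ℚ`-linear retraction `l : F → ℚ`, applied to the second tensor factor, turns `1 ⊗ y = r ⊗ 1`
  -- into `l y = r` in `K`, so `r` is the rational number `l y`.
  obtain ⟨l, hl⟩ := LinearMap.exists_leftInverse_of_injective (Algebra.linearMap ℚ F)
    (LinearMap.ker_eq_bot.2 (algebraMap ℚ F).injective)
  have hl1 : l 1 = 1 := by simpa using LinearMap.congr_fun hl 1
  have key := congrArg (fun y => TensorProduct.rid ℚ K (l.lTensor K y)) h
  obtain ⟨y, rfl⟩ : ∃ y : F, x = 1 ⊗ₜ y :=
    ⟨TensorProduct.lid ℚ F x, ((TensorProduct.lid ℚ F).symm_apply_apply x).symm⟩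
  have hy : baseMap F (algebraMap ℚ K) (1 ⊗ₜ y) = 1 ⊗ₜ y := by simp [baseMap]
  rw [hy] at h key
  simp only [LinearMap.lTensor_tmul, TensorProduct.rid_tmul, hl1, one_smul] at key
  refine ⟨l y, baseMap_injective K F ?_⟩
  rw [hy, h, ← key]
  simp [baseMap, Algebra.smul_def]

/-- A nonzero rational entry of `ψ` is a unit in every `ℚ`-algebra, so the multiplier can be read
off there. For empty `n` the determinant is 1 and every scalar is a multiplier. -/
theorem IsSimilitude.eq_of_nonempty [Nonempty n] {ψ : Matrix n n ℚ} (hψ : ψ.det ≠ 0) {S : Type}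
    [CommRing S] [Algebra ℚ S] {g : GL n S} {c d : S} (hc : IsSimilitude ψ g c)
    (hd : IsSimilitude ψ g d) : c = d := by
  obtain ⟨i, j, hij⟩ : ∃ i j, ψ i j ≠ 0 := by
    by_contra! h
    exact hψ (by rw [show ψ = 0 from Matrix.ext h, Matrix.det_zero])
  have h := congrFun (congrFun (hc.symm.trans hd) i) j
  simp only [Matrix.smul_apply, Matrix.map_apply, smul_eq_mul] at h
  have hu : IsUnit (algebraMap ℚ S (ψ i j)) := (IsUnit.mk0 _ hij).map _
  exact hu.mul_left_injective h

/-- A rational point of `H` that lies in `H₁` over an extension field of `ℚ` lies in `H₁`. -/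
theorem mem_groupH1_of_map {ψ : Matrix n n ℚ} {G : LinAlgGroup ℚ n} (hψ : ψ.det ≠ 0)
    (hGSp : ∀ (R : Type) [CommRing R] [Algebra ℚ R], ∀ g ∈ G.points R,
      ∃ c : Rˣ, IsSimilitude ψ g (c : R))
    {F : Type} [Field F] [Algebra ℚ F] {K : Type} [Field K] [Algebra ℚ K]
    (x : (groupH G F).obj ℚ)
    (h : ((GLFunctor n).weilRes F).map (algebraMap ℚ K) x.1 ∈ (groupH1 ψ G F).obj K) :
    x.1 ∈ (groupH1 ψ G F).obj ℚ := by
  refine GalSubgroup.mem_neutralComponent_of_map (groupH3 ψ G F) ⟨x.2, ?_⟩ h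
  obtain ⟨⟨-, r, hr⟩, -⟩ := h
  obtain ⟨c, hc⟩ := hGSp (ℚ ⊗[ℚ] F) x.1 x.2
  rcases isEmpty_or_nonempty n with hn | hn
  · exact ⟨1, Subsingleton.elim _ _⟩
  -- Over `K` the multiplier in `ℚ ⊗ F` supplied by `GSp` must agree with the scalar `r ⊗ 1`; hence
  -- it was rational from the start.
  have e := IsSimilitude.eq_of_nonempty (S := K ⊗[ℚ] F) hψ
    (IsSimilitude.map (baseMap F (algebraMap ℚ K)) hc) hr
  obtain ⟨s, hs⟩ := exists_rat_of_baseMap_eq (c : ℚ ⊗[ℚ] F) _ e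
  have hs0 : s ≠ 0 := by
    rintro rfl
    rw [TensorProduct.zero_tmul] at hs
    exact c.ne_zero hs
  exact ⟨Units.mk0 s hs0, by rw [Units.val_mk0, ← hs]; exact hc⟩

/-! ### Integrality in `R ⊗ F` and bounded denominators -/

section integrality

variable {F : Type} [Field F] [NumberField F]

/-- The elements of `R ⊗ F` whose coordinates in an integral basis of `F` lie in the subring `R₀`,
i.e. the image of `R₀ ⊗ 𝓞_F`. -/
def integralTensor (F : Type) [Field F] [NumberField F] {R : Type} [CommRing R] [Algebra ℚ R]
    (R₀ : Subring R) : AddSubgroup (R ⊗[ℚ] F) where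
  carrier := {x | ∀ i,
    (Algebra.TensorProduct.basis R (NumberField.integralBasis F)).repr x i ∈ R₀}
  zero_mem' i := by simp
  add_mem' hx hy i := by
    rw [map_add, Finsupp.add_apply]
    exact add_mem (hx i) (hy i)
  neg_mem' hx i := by
    rw [map_neg, Finsupp.neg_apply]
    exact neg_mem (hx i)

variable {R : Type} [CommRing R] [Algebra ℚ R] {R₀ : Subring R}

theorem tmul_mem_integralTensor {r : R} (hr : r ∈ R₀) (a : NumberField.RingOfIntegers F) :
    r ⊗ₜ[ℚ] (a : F) ∈ integralTensor F R₀ := by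
  intro i
  rw [Algebra.TensorProduct.basis_repr_tmul]
  simp only [Finsupp.smul_apply, Finsupp.mapRange_apply, NumberField.integralBasis_repr_apply,
    smul_eq_mul]
  refine mul_mem hr ?_
  simp

theorem sum_repr_integralBasis (x : R ⊗[ℚ] F) :
    ∑ i, (Algebra.TensorProduct.basis R (NumberField.integralBasis F)).repr x i ⊗ₜ[ℚ]
      ((NumberField.RingOfIntegers.basis F i : NumberField.RingOfIntegers F) : F) = x := by
  conv_rhs => rw [← (Algebra.TensorProduct.basis R (NumberField.integralBasis F)).sum_repr x]
  refine Finset.sum_congr rfl fun i _ => ?_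
  rw [Algebra.TensorProduct.basis_apply, NumberField.integralBasis_apply,
    TensorProduct.smul_tmul', smul_eq_mul, mul_one]

/-- Expanding in the integral basis reduces this to pure tensors, where products of basis elements
are again integers of `F`. -/
theorem mul_mem_integralTensor {x y : R ⊗[ℚ] F} (hx : x ∈ integralTensor F R₀)
    (hy : y ∈ integralTensor F R₀) : x * y ∈ integralTensor F R₀ := by
  rw [← sum_repr_integralBasis x, ← sum_repr_integralBasis y, Finset.sum_mul_sum]
  refine sum_mem fun i _ => sum_mem fun j _ => ?_
  rw [Algebra.TensorProduct.tmul_mul_tmul, ← map_mul]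
  exact tmul_mem_integralTensor (mul_mem (hx i) (hy j)) _

/-- `D` is a common denominator of the entries of a matrix over `R ⊗ F`. -/
def IsDenominator (R₀ : Subring R) (D : ℕ) (g : Matrix n n (R ⊗[ℚ] F)) : Prop :=
  ∀ i j, D • g i j ∈ integralTensor F R₀

theorem IsDenominator.mul {D E : ℕ} {g h : Matrix n n (R ⊗[ℚ] F)} (hg : IsDenominator R₀ D g)
    (hh : IsDenominator R₀ E h) : IsDenominator R₀ (D * E) (g * h) := by
  intro i j
  rw [Matrix.mul_apply, Finset.smul_sum]
  refine sum_mem fun k _ => ?_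
  have : (D * E) • (g i k * h k j) = (D • g i k) * (E • h k j) := by
    simp only [nsmul_eq_mul]; push_cast; ring
  rw [this]
  exact mul_mem_integralTensor (hg i k) (hh k j)

/-- Every element of `R` becomes an element of `R₀` after multiplication by a positive integer. -/
def HasDenominators (R₀ : Subring R) : Prop :=
  ∀ x : R, ∃ D : ℕ, D ≠ 0 ∧ D • x ∈ R₀

/-- The open sets `{x | D • x ∈ R₀}` cover `R` and are directed under divisibility of `D`, so one of
them contains the compact set. -/
theorem HasDenominators.exists_of_isCompact (h : HasDenominators R₀) [TopologicalSpace R]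
    [IsTopologicalRing R] (hopen : IsOpen (R₀ : Set R)) {C : Set R} (hC : IsCompact C) :
    ∃ D : ℕ, D ≠ 0 ∧ ∀ x ∈ C, D • x ∈ R₀ := by
  have : Nonempty {D : ℕ // D ≠ 0} := ⟨⟨1, one_ne_zero⟩⟩
  obtain ⟨D, hD⟩ := hC.elim_directed_cover (fun D : {D : ℕ // D ≠ 0} => {x : R | D.1 • x ∈ R₀})
    (fun D => hopen.preimage (continuous_const_smul D.1))
    (fun x _ => by
      obtain ⟨D, hD, hx⟩ := h x
      exact Set.mem_iUnion.2 ⟨⟨D, hD⟩, hx⟩)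
    (fun D E => ⟨⟨D.1 * E.1, mul_ne_zero D.2 E.2⟩, fun x hx => by
        change (D.1 * E.1) • x ∈ R₀
        rw [mul_comm, mul_smul]
        exact nsmul_mem hx _, fun x hx => by
        change (D.1 * E.1) • x ∈ R₀
        rw [mul_smul]
        exact nsmul_mem hx _⟩)
  exact ⟨D.1, D.2, fun x hx => hD hx⟩

theorem exists_forall_of_finite {ι : Type*} [Finite ι] {p : ι → ℕ → Prop}
    (hp : ∀ i D E, p i D → D ∣ E → p i E) (h : ∀ i, ∃ D, D ≠ 0 ∧ p i D) :
    ∃ D, D ≠ 0 ∧ ∀ i, p i D := by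
  cases nonempty_fintype ι
  choose D hD hp' using h
  exact ⟨∏ i, D i, Finset.prod_ne_zero_iff.2 fun i _ => hD i,
    fun i => hp i _ _ (hp' i) (Finset.dvd_prod_of_mem _ (Finset.mem_univ i))⟩

theorem nsmul_mem_of_dvd {A : Type*} [AddCommGroup A] {S : Type*} [SetLike S A]
    [AddSubgroupClass S A] {s : S} {x : A} {D E : ℕ} (hx : D • x ∈ s) (h : D ∣ E) : E • x ∈ s := by
  obtain ⟨c, rfl⟩ := h
  rw [mul_comm, mul_smul]
  exact nsmul_mem hx c

theorem exists_isDenominator_of_forall (Z : Set (Matrix n n (R ⊗[ℚ] F)))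
    (h : ∀ i j k, ∃ D : ℕ, D ≠ 0 ∧ ∀ g ∈ Z, D •
      (Algebra.TensorProduct.basis R (NumberField.integralBasis F)).repr (g i j) k ∈ R₀) :
    ∃ D : ℕ, D ≠ 0 ∧ ∀ g ∈ Z, IsDenominator R₀ D g := by
  obtain ⟨D, hD, hp⟩ := exists_forall_of_finite
    (p := fun (t : n × n × Module.Free.ChooseBasisIndex ℤ (NumberField.RingOfIntegers F)) D =>
      ∀ g ∈ Z, D • (Algebra.TensorProduct.basis R (NumberField.integralBasis F)).repr
        (g t.1 t.2.1) t.2.2 ∈ R₀)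
    (fun t D E h hDE g hg => nsmul_mem_of_dvd (h g hg) hDE) (fun t => h t.1 t.2.1 t.2.2)
  refine ⟨D, hD, fun g hg i j k => ?_⟩
  rw [map_nsmul, Finsupp.smul_apply]
  exact hp (i, j, k) g hg

theorem HasDenominators.exists_isDenominator (h : HasDenominators R₀)
    (g : Matrix n n (R ⊗[ℚ] F)) : ∃ D : ℕ, D ≠ 0 ∧ IsDenominator R₀ D g := by
  obtain ⟨D, hD, hg⟩ := exists_isDenominator_of_forall (R₀ := R₀) {g} fun i j k => by
    obtain ⟨D, hD, hx⟩ := h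
      ((Algebra.TensorProduct.basis R (NumberField.integralBasis F)).repr (g i j) k)
    exact ⟨D, hD, fun g' hg' => by rw [Set.mem_singleton_iff.1 hg']; exact hx⟩
  exact ⟨D, hD, hg g rfl⟩

/-- Linear coordinates are continuous for the module topology, so each coordinate of each matrix
entry takes `K` to a compact subset of `R`. -/
theorem HasDenominators.exists_isDenominator_of_isCompact (h : HasDenominators R₀)
    [TopologicalSpace R] [IsTopologicalRing R] (hopen : IsOpen (R₀ : Set R))
    {P : GalSubgroup F (GLFunctor n)} {K : Subgroup (P.obj R)} (hK : IsCompact (K : Set (P.obj R))) :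
    ∃ D : ℕ, D ≠ 0 ∧ ∀ g ∈ K, IsDenominator R₀ D (g.1 : GL n (R ⊗[ℚ] F)).val := by
  obtain ⟨D, hD, hg⟩ := exists_isDenominator_of_forall (R₀ := R₀)
    ((fun g : P.obj R => (g.1 : GL n (R ⊗[ℚ] F)).val) '' K) fun i j k => by
      let _ : TopologicalSpace (R ⊗[ℚ] F) := moduleTopology R (R ⊗[ℚ] F)
      have : IsModuleTopology R (R ⊗[ℚ] F) := ⟨rfl⟩
      have hval : Continuous (fun g : P.obj R => (g.1 : (Matrix n n (R ⊗[ℚ] F))ˣ).val) :=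
        Units.continuous_val.comp continuous_subtype_val
      have hcoord : Continuous
          ((Algebra.TensorProduct.basis R (NumberField.integralBasis F)).coord k) :=
        IsModuleTopology.continuous_of_linearMap _
      have hc := hcoord.comp (((continuous_apply j).comp (continuous_apply i)).comp hval)
      obtain ⟨D, hD, hx⟩ := h.exists_of_isCompact hopen (hK.image hc)
      refine ⟨D, hD, ?_⟩
      rintro _ ⟨g, hg, rfl⟩
      exact hx _ ⟨g, hg, rfl⟩
  exact ⟨D, hD, fun g hgK => hg _ ⟨g, hgK, rfl⟩⟩

/-- The entries of the elements of a conjugate of a compact subgroup have bounded denominators. -/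
theorem HasDenominators.exists_isDenominator_conj (h : HasDenominators R₀)
    [TopologicalSpace R] [IsTopologicalRing R] (hopen : IsOpen (R₀ : Set R))
    {P : GalSubgroup F (GLFunctor n)} {K : Subgroup (P.obj R)} (hK : IsCompact (K : Set (P.obj R)))
    (g : P.obj R) :
    ∃ D : ℕ, D ≠ 0 ∧ ∀ x : P.obj R, g⁻¹ * x * g ∈ K →
      IsDenominator R₀ D (x.1 : GL n (R ⊗[ℚ] F)).val := by
  obtain ⟨D, hD, hd⟩ := h.exists_isDenominator_of_isCompact hopen hK
  obtain ⟨D₁, hD₁, hd₁⟩ := h.exists_isDenominator (g.1 : GL n (R ⊗[ℚ] F)).val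
  obtain ⟨D₂, hD₂, hd₂⟩ := h.exists_isDenominator ((g⁻¹).1 : GL n (R ⊗[ℚ] F)).val
  -- The factors clear `g`, the compact group and `g⁻¹`, in the order of `x = g (g⁻¹ x g) g⁻¹`.
  refine ⟨D₁ * D * D₂, by positivity, fun x hx => ?_⟩
  have := (hd₁.mul (hd _ hx)).mul hd₂
  have e : x = g * (g⁻¹ * x * g) * g⁻¹ := by group
  rw [e]
  exact this

end integrality

/-! ### Integral finite adeles -/

/-- The subring `ℤ_v` of `ℚ_v`. -/
def Qv.integers (v : HeightOneSpectrum ℤ) : Subring (Qv v) :=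
  (v.adicCompletionIntegers ℚ).toSubring

/-- The subring of integral elements of `𝔸_f^v`. -/
def AfAway.integers (v : HeightOneSpectrum ℤ) : Subring (AfAway v) :=
  ⨅ w : {w : HeightOneSpectrum ℤ // w ≠ v}, (Qv.integers w.1).comap (AfAway.toQv w)

theorem AfAway.mem_integers {v : HeightOneSpectrum ℤ} {x : AfAway v} :
    x ∈ AfAway.integers v ↔ ∀ w, AfAway.toQv w x ∈ Qv.integers w.1 := by
  simp [AfAway.integers, Subring.mem_iInf]

instance (v : HeightOneSpectrum ℤ) : IsTopologicalRing (Qv v) :=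
  inferInstanceAs (IsTopologicalRing (v.adicCompletion ℚ))

instance (v : HeightOneSpectrum ℤ) : IsTopologicalRing (AfAway v) :=
  haveI : Fact (∀ w : {w : HeightOneSpectrum ℤ // w ≠ v},
      IsOpen (w.1.adicCompletionIntegers ℚ : Set (w.1.adicCompletion ℚ))) :=
    ⟨fun _ ↦ Valued.isOpen_valuationSubring _⟩
  RestrictedProduct.isTopologicalRing
    (fun w : {w : HeightOneSpectrum ℤ // w ≠ v} => w.1.adicCompletion ℚ)

theorem Qv.isOpen_integers (v : HeightOneSpectrum ℤ) : IsOpen (Qv.integers v : Set (Qv v)) :=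
  Valued.isOpen_valuationSubring (v.adicCompletion ℚ)

theorem AfAway.isOpen_integers (v : HeightOneSpectrum ℤ) :
    IsOpen (AfAway.integers v : Set (AfAway v)) := by
  have h := RestrictedProduct.isOpen_forall_mem
    (R := fun w : {w : HeightOneSpectrum ℤ // w ≠ v} => w.1.adicCompletion ℚ)
    (A := fun w => (w.1.adicCompletionIntegers ℚ : Set (w.1.adicCompletion ℚ)))
    (fun _ ↦ Valued.isOpen_valuationSubring _)
  have e : (AfAway.integers v : Set (AfAway v)) =
      {x | ∀ w, AfAway.toQv w x ∈ Qv.integers w.1} := Set.ext fun x => AfAway.mem_integers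
  rw [e]
  exact h

/-- Since `ℚ` is dense and the integers are open, `x` differs from some rational `q` by an integral
element, and the denominator of `q` clears `x`. -/
theorem Qv.hasDenominators (v : HeightOneSpectrum ℤ) : HasDenominators (Qv.integers v) := by
  intro x
  have hopen : IsOpen {y : Qv v | x - y ∈ Qv.integers v} :=
    (Qv.isOpen_integers v).preimage (continuous_const.sub continuous_id)
  have hdense : DenseRange (algebraMap ℚ (Qv v)) := HeightOneSpectrum.denseRange_algebraMap ℚ v
  obtain ⟨q, hq⟩ := hdense.exists_mem_open hopen ⟨x, by simp [zero_mem]⟩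
  refine ⟨q.den, q.den_ne_zero, ?_⟩
  have e : q.den • x = q.den • (x - algebraMap ℚ (Qv v) q) + (q.num : Qv v) := by
    rw [smul_sub, nsmul_eq_mul q.den (algebraMap ℚ (Qv v) q),
      ← map_natCast (algebraMap ℚ (Qv v)), ← map_mul, Rat.den_mul_eq_num, map_intCast]
    ring
  rw [e]
  exact add_mem (nsmul_mem hq _) (intCast_mem _ _)

/-- Only finitely many components fail to be integral; the product of their local denominators
clears all of them. -/
theorem AfAway.hasDenominators (v : HeightOneSpectrum ℤ) :
    HasDenominators (AfAway.integers v) := by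
  intro x
  have hfin : {w : {w : HeightOneSpectrum ℤ // w ≠ v} |
      AfAway.toQv w x ∉ Qv.integers w.1}.Finite := x.2
  have h := fun w : {w : HeightOneSpectrum ℤ // w ≠ v} =>
    Qv.hasDenominators w.1 (AfAway.toQv w x)
  choose D hD hx using h
  refine ⟨∏ w ∈ hfin.toFinset, D w, Finset.prod_ne_zero_iff.2 fun w _ => hD w,
    AfAway.mem_integers.2 fun w => ?_⟩
  rw [map_nsmul]
  by_cases hw : AfAway.toQv w x ∈ Qv.integers w.1
  · exact nsmul_mem hw _
  · exact nsmul_mem_of_dvd (hx w) (Finset.dvd_prod_of_mem _ (hfin.mem_toFinset.2 hw))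

/-- A rational number that is integral at all places is an integer. -/
theorem exists_int_of_mem_integers {v : HeightOneSpectrum ℤ} {x : ℚ}
    (haway : algebraMap ℚ (AfAway v) x ∈ AfAway.integers v)
    (hat : algebraMap ℚ (Qv v) x ∈ Qv.integers v) : ∃ m : ℤ, (m : ℚ) = x := by
  refine HeightOneSpectrum.mem_integers_of_valuation_le_one ℚ x fun w => ?_
  rw [← HeightOneSpectrum.valuedAdicCompletion_eq_valuation' w x]
  by_cases hw : w = v
  · subst hw
    exact hat
  · exact AfAway.mem_integers.1 haway ⟨w, hw⟩

theorem basis_repr_baseMap {F : Type} [Field F] [NumberField F] {R : Type} [CommRing R]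
    [Algebra ℚ R] (x : ℚ ⊗[ℚ] F) (i : Module.Free.ChooseBasisIndex ℤ (NumberField.RingOfIntegers F)) :
    (Algebra.TensorProduct.basis R (NumberField.integralBasis F)).repr
      (baseMap F (algebraMap ℚ R) x) i = algebraMap ℚ R
      ((Algebra.TensorProduct.basis ℚ (NumberField.integralBasis F)).repr x i) := by
  induction x with
  | zero => simp
  | add x y hx hy => simp only [map_add, Finsupp.add_apply, hx, hy]
  | tmul r a => simp [baseMap, Algebra.smul_def]

/-- An element of `F` that is integral at all finite places of `ℚ` is an algebraic integer. -/
theorem isIntegral_of_mem_integralTensor {F : Type} [Field F] [NumberField F]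
    {v : HeightOneSpectrum ℤ} {x : ℚ ⊗[ℚ] F}
    (haway : baseMap F (algebraMap ℚ (AfAway v)) x ∈ integralTensor F (AfAway.integers v))
    (hat : baseMap F (algebraMap ℚ (Qv v)) x ∈ integralTensor F (Qv.integers v)) :
    IsIntegral ℤ (Algebra.TensorProduct.lid ℚ F x) := by
  have hint : ∀ i, ∃ m : ℤ, (m : ℚ) =
      (Algebra.TensorProduct.basis ℚ (NumberField.integralBasis F)).repr x i := fun i =>
    exists_int_of_mem_integers (by rw [← basis_repr_baseMap]; exact haway i)
      (by rw [← basis_repr_baseMap]; exact hat i)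
  rw [← sum_repr_integralBasis x, map_sum]
  refine IsIntegral.sum _ fun i _ => ?_
  obtain ⟨m, hm⟩ := hint i
  rw [← hm, Algebra.TensorProduct.lid_tmul]
  have e : (m : ℚ) • ((NumberField.RingOfIntegers.basis F i : NumberField.RingOfIntegers F) : F) =
    ((m • NumberField.RingOfIntegers.basis F i : NumberField.RingOfIntegers F) : F) := by
    simp [Rat.smul_def]
  rw [e]
  exact NumberField.RingOfIntegers.isIntegral_coe _

/-! ### Eigenvalues of automorphisms of prime order -/

/-- In characteristic zero the roots of $1+X+\dots+X^{p-1}$ are exactly the elements of order $p$.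
If none is an eigenvalue, this polynomial is coprime to the characteristic polynomial, so by Bézout
and Cayley–Hamilton its value at `T` is invertible; multiplied by `T - 1` it gives `T ^ p - 1 = 0`,
forcing `T = 1`. -/
theorem exists_eigenvalue_orderOf_eq {K V : Type*} [Field K] [CharZero K] [AddCommGroup V]
    [Module K V] [Module.Finite K V] {p : ℕ} (hp : p.Prime) {T : Module.End K V} (hT : T ^ p = 1)
    (hT1 : T ≠ 1) : ∃ u : (AlgebraicClosure K)ˣ,
      Polynomial.aeval (u : AlgebraicClosure K) (LinearMap.charpoly T) = 0 ∧ orderOf u = p := by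
  by_contra! hno
  have hcop : IsCoprime (∑ i ∈ Finset.range p, (Polynomial.X : Polynomial K) ^ i)
      (LinearMap.charpoly T) := by
    rw [Polynomial.isCoprime_iff_aeval_ne_zero_of_isAlgClosed K (AlgebraicClosure K)]
    intro a
    by_contra! h
    obtain ⟨h1, h2⟩ := h
    simp only [map_sum, map_pow, Polynomial.aeval_X] at h1
    have hap : a ^ p = 1 := by
      rw [← sub_eq_zero, ← geom_sum_mul, h1, zero_mul]
    have ha0 : a ≠ 0 := by
      rintro rfl
      rw [zero_pow hp.ne_zero] at hap
      exact zero_ne_one hap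
    have ha1 : a ≠ 1 := by
      rintro rfl
      simp [hp.ne_zero] at h1
    have := Fact.mk hp
    refine hno (Units.mk0 a ha0) h2 (orderOf_eq_prime (Units.ext ?_) fun h => ha1 ?_)
    · simpa using hap
    · simpa using congrArg Units.val h
  obtain ⟨a, b, hab⟩ := hcop
  apply hT1
  have h := congrArg (Polynomial.aeval T) hab
  simp only [map_add, map_mul, LinearMap.aeval_self_charpoly, mul_zero, add_zero, map_sum, map_pow,
    Polynomial.aeval_X, map_one] at h
  have hz : (∑ i ∈ Finset.range p, T ^ i) * (T - 1) = 0 := by rw [geom_sum_mul, hT, sub_self]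
  have := congrArg (· * (T - 1)) h
  simp only [mul_assoc, hz, mul_zero, one_mul] at this
  exact (sub_eq_zero.1 this.symm)

theorem exists_mem_eigenvalueGroup_orderOf_eq {F : Type} [Field F] [NumberField F] {K : Type}
    [Field K] [Algebra ℚ K] {p : ℕ} (hp : p.Prime) {g : GL n (K ⊗[ℚ] F)} (hg : orderOf g = p) :
    ∃ ζ ∈ eigenvalueGroup g, orderOf ζ = p := by
  have : CharZero K := algebraRat.charZero K
  obtain ⟨u, hu, hup⟩ := exists_eigenvalue_orderOf_eq (K := K) hp
    (T := (Matrix.toLin' g.val).restrictScalars K) (by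
      have h : Matrix.toLin' g.val ^ p = 1 := by
        rw [← Matrix.toLin'_pow, ← Units.val_pow_eq_pow_val, ← hg, pow_orderOf_eq_one]
        exact Matrix.toLin'_one
      refine LinearMap.ext fun x => ?_
      have := LinearMap.congr_fun h x
      rw [Module.End.pow_apply] at this ⊢
      exact this) (by
      intro h
      have hg1 : g = 1 := by
        refine Units.ext (Matrix.toLin'.injective ?_)
        refine LinearMap.ext fun x => ?_
        rw [Units.val_one, Matrix.toLin'_one]
        exact LinearMap.congr_fun h x
      rw [hg1, orderOf_one] at hg
      exact hp.one_lt.ne hg)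
  exact ⟨u, Subgroup.subset_closure hu, hup⟩

/-- An element of finite order of `P(ℚ)` which lies in a conjugate of a neat subgroup is trivial. -/
theorem IsNeat.eq_one_of_isOfFinOrder {F : Type} [Field F] [NumberField F]
    {v : HeightOneSpectrum ℤ} {P : GalSubgroup F (GLFunctor n)} {K : Subgroup (P.obj (AfAway v))}
    (hK : IsNeat K) (g : P.obj (AfAway v)) {q : P.obj ℚ} (hq : IsOfFinOrder q)
    (hqK : g⁻¹ * P.map (algebraMap ℚ (AfAway v)) q * g ∈ K) : q = 1 := by
  by_contra hq1
  have hord : orderOf q ≠ 1 := fun h => hq1 (orderOf_eq_one_iff.1 h)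
  -- Passing to a power of prime order `p` lets neatness be applied with `m = p`.
  obtain ⟨p, hp, hdvd⟩ := Nat.exists_prime_and_dvd hord
  have hordpow : orderOf (q ^ (orderOf q / p)) = p :=
    orderOf_pow_orderOf_div (orderOf_pos_iff.2 hq).ne' hdvd
  have hmem := pow_mem hqK (orderOf q / p)
  have hconj : (g⁻¹ * P.map (algebraMap ℚ (AfAway v)) q * g) ^ (orderOf q / p) =
      g⁻¹ * P.map (algebraMap ℚ (AfAway v)) (q ^ (orderOf q / p)) * g := by
    rw [map_pow]
    simpa using conj_pow (i := orderOf q / p) (a := g⁻¹)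
      (b := P.map (algebraMap ℚ (AfAway v)) q)
  obtain ⟨w, hw⟩ := hK _ hmem p hp.one_lt
  set q' := q ^ (orderOf q / p)
  have hinj : Function.Injective
      ((P.obj (Qv w.1)).subtype.comp (P.map (algebraMap ℚ (Qv w.1)))) := by
    intro a b hab
    have hab' : (a.1 : GL n (ℚ ⊗[ℚ] F)) = b.1 := by
      refine Units.ext (Matrix.ext fun i j => baseMap_injective (Qv w.1) F ?_)
      exact congrFun (congrFun (congrArg (fun u : GL n (Qv w.1 ⊗[ℚ] F) => u.val) hab) i) j
    exact Subtype.ext hab'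
  have hmap : P.map (AfAway.toQv w) (P.map (algebraMap ℚ (AfAway v)) q') =
      P.map (algebraMap ℚ (Qv w.1)) q' := by
    rw [P.map_map]
    exact congrArg (fun f => P.map f q') (Subsingleton.elim _ _)
  -- The order survives at `w`, since rational points inject into the points over `ℚ_w` and
  -- conjugation is injective.
  have hord' : orderOf ((P.map (AfAway.toQv w)
      (g⁻¹ * P.map (algebraMap ℚ (AfAway v)) q' * g)).1) = p := by
    rw [map_mul, map_mul, map_inv, hmap, ← hordpow]
    simpa using orderOf_injective ((MulAut.conj (P.map (AfAway.toQv w) g).1⁻¹).toMonoidHom.comp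
      ((P.obj (Qv w.1)).subtype.comp (P.map (algebraMap ℚ (Qv w.1)))))
      ((MulAut.conj _).injective.comp hinj) q'
  rw [hconj] at hw
  obtain ⟨ζ, hζ, hζp⟩ := exists_mem_eigenvalueGroup_orderOf_eq hp hord'
  exact hw ζ hζ hζp

/-! ### Similitudes of definite forms -/

/-- The constant is the minimum of the form on the compact unit sphere, extended by homogeneity. The
sphere is empty only for the zero space, where any constant works. -/
theorem exists_pos_mul_sq_norm_le {M : Matrix n n ℝ}
    (hM : ∀ x : n → ℝ, x ≠ 0 → 0 < x ⬝ᵥ (M *ᵥ x)) :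
    ∃ c : ℝ, 0 < c ∧ ∀ x : n → ℝ, c * ‖x‖ ^ 2 ≤ x ⬝ᵥ (M *ᵥ x) := by
  have hcont : Continuous fun x : n → ℝ => x ⬝ᵥ (M *ᵥ x) := by
    simp only [dotProduct, Matrix.mulVec]
    fun_prop
  rcases (Metric.sphere (0 : n → ℝ) 1).eq_empty_or_nonempty with he | hne
  · refine ⟨1, one_pos, fun x => ?_⟩
    have hx : x = 0 := by
      by_contra hx
      have : ‖x‖⁻¹ • x ∈ Metric.sphere (0 : n → ℝ) 1 := by
        simp [norm_smul, norm_ne_zero_iff.2 hx]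
      rw [he] at this
      exact this
    simp [hx]
  · obtain ⟨u, hu, hmin⟩ := (isCompact_sphere (0 : n → ℝ) 1).exists_isMinOn hne hcont.continuousOn
    have hu0 : u ≠ 0 := ne_zero_of_mem_unit_sphere ⟨u, hu⟩
    refine ⟨_, hM u hu0, fun x => ?_⟩
    by_cases hx : x = 0
    · simp [hx]
    have hx' : ‖x‖ ≠ 0 := norm_ne_zero_iff.2 hx
    have h := hmin (show ‖x‖⁻¹ • x ∈ Metric.sphere (0 : n → ℝ) 1 by simp [norm_smul, hx'])
    simp only [Set.mem_ofPred_eq, Matrix.mulVec_smul, smul_dotProduct, dotProduct_smul,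
      smul_eq_mul] at h
    calc _ ≤ ‖x‖⁻¹ * (‖x‖⁻¹ * x ⬝ᵥ (M *ᵥ x)) * ‖x‖ ^ 2 := by gcongr
      _ = _ := by field_simp

theorem dotProduct_mulVec_of_similitude {M A : Matrix n n ℝ} {r : ℝ} (hA : Aᵀ * M * A = r • M)
    (x : n → ℝ) : (A *ᵥ x) ⬝ᵥ (M *ᵥ (A *ᵥ x)) = r * (x ⬝ᵥ (M *ᵥ x)) := by
  rw [← smul_eq_mul, ← dotProduct_smul, ← Matrix.smul_mulVec, ← hA, ← Matrix.mulVec_mulVec,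
    ← Matrix.mulVec_mulVec, Matrix.dotProduct_mulVec x, Matrix.vecMul_transpose]

/-- The form is positive at the all-ones vector and at its image, and `r` is the ratio of the two
values. -/
theorem pos_of_similitude [Nonempty n] {M : Matrix n n ℝ}
    (hM : ∀ x : n → ℝ, x ≠ 0 → 0 < x ⬝ᵥ (M *ᵥ x)) {A : GL n ℝ} {r : ℝ}
    (hA : A.valᵀ * M * A.val = r • M) : 0 < r := by
  have hx : (1 : n → ℝ) ≠ 0 := one_ne_zero
  have hAx : A.val *ᵥ (1 : n → ℝ) ≠ 0 := fun h => hx (by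
    have := congrArg ((A⁻¹).val *ᵥ ·) h
    simp [Matrix.mulVec_mulVec] at this)
  have h := hM _ hAx
  rw [dotProduct_mulVec_of_similitude hA] at h
  exact pos_of_mul_pos_left h (hM _ hx).le

/-- The entries of the isometries of a definite form are bounded. -/
theorem exists_forall_abs_le_of_isometry {M : Matrix n n ℝ}
    (hM : ∀ x : n → ℝ, x ≠ 0 → 0 < x ⬝ᵥ (M *ᵥ x)) :
    ∃ B : ℝ, ∀ A : Matrix n n ℝ, Aᵀ * M * A = M → ∀ i j, |A i j| ≤ B := by
  obtain ⟨c, hc, h⟩ := exists_pos_mul_sq_norm_le hM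
  -- With $e_j$ the standard basis vector, $c\,\|Ae_j\|^2\le (Ae_j)^tM(Ae_j)=M_{jj}$, and $A_{ij}$
  -- is a coordinate of $Ae_j$. Summing over $j$ makes the bound uniform.
  refine ⟨√((∑ j, |M j j|) / c), fun A hA i j => Real.abs_le_sqrt ?_⟩
  have h1 := dotProduct_mulVec_of_similitude (r := 1) (by rw [hA, one_smul]) (Pi.single j 1)
  have h2 := h (A *ᵥ Pi.single j 1)
  rw [h1] at h2
  simp only [Matrix.mulVec_single_one, single_one_dotProduct, one_mul, Matrix.col_apply] at h2
  have h3 : |A i j| ≤ ‖A.col j‖ := norm_le_pi_norm (A.col j) i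
  have h4 : |M j j| ≤ ∑ j, |M j j| :=
    Finset.single_le_sum (f := fun j => |M j j|) (fun _ _ => abs_nonneg _) (Finset.mem_univ j)
  rw [le_div_iff₀ hc, ← sq_abs, mul_comm]
  calc c * |A i j| ^ 2 ≤ c * ‖A.col j‖ ^ 2 := by gcongr
    _ ≤ M j j := h2
    _ ≤ _ := (le_abs_self _).trans h4

theorem exists_forall_abs_le_of_conj_isometry {M : Matrix n n ℝ}
    (hM : ∀ x : n → ℝ, x ≠ 0 → 0 < x ⬝ᵥ (M *ᵥ x)) (p : GL n ℝ) :
    ∃ B : ℝ, ∀ A : GL n ℝ, (p⁻¹ * A * p).valᵀ * M * (p⁻¹ * A * p).val = M →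
      ∀ i j, |A.val i j| ≤ B := by
  obtain ⟨B, hB⟩ := exists_forall_abs_le_of_isometry hM
  refine ⟨∑ i, ∑ j, ∑ a, (∑ b, |p.val i b| * B) * |(p⁻¹).val a j|, fun A hA i j => ?_⟩
  have hB0 : 0 ≤ B := (abs_nonneg _).trans (hB _ hA i j)
  have e : A.val = p.val * (p⁻¹ * A * p).val * (p⁻¹).val := by
    rw [← Units.val_mul, ← Units.val_mul]
    congr 1
    group
  have h : |A.val i j| ≤ ∑ a, (∑ b, |p.val i b| * B) * |(p⁻¹).val a j| := by
    rw [e, Matrix.mul_apply]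
    refine (Finset.abs_sum_le_sum_abs _ _).trans (Finset.sum_le_sum fun a _ => ?_)
    rw [abs_mul, Matrix.mul_apply]
    gcongr
    refine (Finset.abs_sum_le_sum_abs _ _).trans (Finset.sum_le_sum fun b _ => ?_)
    rw [abs_mul]
    gcongr
    exact hB _ hA b a
  refine h.trans ?_
  have hnn : ∀ i j, 0 ≤ ∑ a, (∑ b, |p.val i b| * B) * |(p⁻¹).val a j| := fun i j => by positivity
  exact (Finset.single_le_sum (f := fun j => ∑ a, (∑ b, |p.val i b| * B) * |(p⁻¹).val a j|)
    (fun j _ => hnn i j) (Finset.mem_univ j)).trans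
    (Finset.single_le_sum (f := fun i => ∑ j, ∑ a, (∑ b, |p.val i b| * B) * |(p⁻¹).val a j|)
    (fun i _ => Finset.sum_nonneg fun j _ => hnn i j) (Finset.mem_univ i))

/-! ### Stabilizers -/

section stabilizers

variable {F : Type} [Field F] [NumberField F]

/-- The ring homomorphism `ℝ ⊗ F → ℝ` given by a real embedding of `F`. -/
def realPlace (σ : F →+* ℝ) : ℝ ⊗[ℚ] F →+* ℝ :=
  (Algebra.TensorProduct.productMap (AlgHom.id ℚ ℝ) σ.toRatAlgHom).toRingHom

theorem realPlace_tmul (σ : F →+* ℝ) (r : ℝ) (x : F) : realPlace σ (r ⊗ₜ x) = r * σ x := by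
  simp [realPlace]

/-- The isomorphism `ℚ ⊗ F ≅ F`. -/
def lidHom (F : Type) [Field F] [NumberField F] : ℚ ⊗[ℚ] F →+* F :=
  (Algebra.TensorProduct.lid ℚ F : ℚ ⊗[ℚ] F →+* F)

theorem lidHom_tmul_one (r : ℚ) : lidHom F (r ⊗ₜ 1) = algebraMap ℚ F r := by
  simp [lidHom, Algebra.smul_def]

theorem lidHom_injective : Function.Injective (lidHom F) :=
  (Algebra.TensorProduct.lid ℚ F).injective

theorem realPlace_comp_baseMap (σ : F →+* ℝ) :
    (realPlace σ).comp (baseMap F (algebraMap ℚ ℝ)) = σ.comp (lidHom F) := by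
  refine RingHom.ext fun x => ?_
  induction x with
  | zero => simp
  | add x y hx hy => rw [map_add, hx, hy, map_add]
  | tmul r x => simp [baseMap, realPlace_tmul, lidHom, Rat.smul_def]

/-- The matrix over `F` of a rational point. -/
def matrixOver {P : GalSubgroup F (GLFunctor n)} : P.obj ℚ →* GL n F :=
  (Matrix.GeneralLinearGroup.map (lidHom F)).comp (P.obj ℚ).subtype

theorem matrixOver_apply {P : GalSubgroup F (GLFunctor n)} (q : P.obj ℚ) (i j : n) :
    (matrixOver q).val i j = lidHom F ((q.1 : GL n (ℚ ⊗[ℚ] F)).val i j) := rfl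

theorem matrixOver_injective {P : GalSubgroup F (GLFunctor n)} :
    Function.Injective (matrixOver (P := P)) := by
  intro a b hab
  have hab' : (a.1 : GL n (ℚ ⊗[ℚ] F)) = b.1 := by
    refine Units.ext (Matrix.ext fun i j => lidHom_injective ?_)
    exact congrFun (congrFun (congrArg (fun u : GL n F => u.val) hab) i) j
  exact Subtype.ext hab'

/-- At a real place of `F`, the stabilizer of a point of `Y₁` acts, after conjugation, by
similitudes of a positive definite form. -/
theorem exists_definite_form_of_mem_spaceY {ψ : Matrix n n ℚ} {G : LinAlgGroup ℚ n}
    {X : Set (DeligneHom (GLFunctor n))} (hψ : IsHodgeEmbedding ψ G X)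
    (y : spaceY (groupH1 ψ G F) X) (σ : F →+* ℝ) :
    ∃ (p : GL n ℝ) (M : Matrix n n ℝ), (∀ x : n → ℝ, x ≠ 0 → 0 < x ⬝ᵥ (M *ᵥ x)) ∧
      ∀ q : (groupH1 ψ G F).obj ℚ, q • y = y → ∀ r : ℚ,
        IsSimilitude ψ (matrixOver q) (algebraMap ℚ F r) →
        (p⁻¹ * Matrix.GeneralLinearGroup.map σ (matrixOver q) * p).valᵀ * M *
          (p⁻¹ * Matrix.GeneralLinearGroup.map σ (matrixOver q) * p).val = (r : ℝ) • M := by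
  obtain ⟨y, h, hh, p₀, hp₀, rfl⟩ := y
  let Φ : ((GLFunctor n).weilRes F).obj ℝ →* GL n ℝ :=
    Matrix.GeneralLinearGroup.map (realPlace σ)
  let J : GL n ℝ := h.at unitI
  -- The element coming from `G(ℝ)` has the same component `J = h(i)` at every real place of `F`.
  have hJ : Φ (((GLFunctor n).toWeilRes F).app ℝ J) = J := by
    refine Units.ext (Matrix.ext fun i j => ?_)
    change realPlace σ (J.val i j ⊗ₜ 1) = J.val i j
    rw [realPlace_tmul, map_one, mul_one]
  -- `M` is `ψ J` or its negative, whichever is positive. A similitude of `ψ` that commutes with `J`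
  -- is a similitude of `M` with the same multiplier.
  obtain ⟨M, hMpos, hM⟩ : ∃ M : Matrix n n ℝ, (∀ x : n → ℝ, x ≠ 0 → 0 < x ⬝ᵥ (M *ᵥ x)) ∧
      ∀ (A : GL n ℝ) (r : ℝ), A * J = J * A → IsSimilitude ψ A r →
        A.valᵀ * M * A.val = r • M := by
    have key : ∀ (A : GL n ℝ) (r : ℝ), A * J = J * A → IsSimilitude ψ A r →
        A.valᵀ * (ψ.map (algebraMap ℚ ℝ) * J.val) * A.val =
          r • (ψ.map (algebraMap ℚ ℝ) * J.val) := by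
      intro A r hAJ hA
      have hAJ' : A.val * J.val = J.val * A.val := congrArg Units.val hAJ
      rw [Matrix.mul_assoc, Matrix.mul_assoc, ← hAJ', ← Matrix.mul_assoc, ← Matrix.mul_assoc, hA,
        Matrix.smul_mul]
    rcases hψ.definite h hh with hd | hd
    · refine ⟨_, fun x hx => ?_, key⟩
      rw [← Matrix.mulVec_mulVec]
      exact hd x hx
    · refine ⟨-(ψ.map (algebraMap ℚ ℝ) * J.val), fun x hx => ?_, fun A r hAJ hA => ?_⟩
      · rw [Matrix.neg_mulVec, dotProduct_neg, ← Matrix.mulVec_mulVec]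
        exact neg_pos.2 (hd x hx)
      · rw [Matrix.mul_neg, Matrix.neg_mul, key A r hAJ hA, smul_neg]
  refine ⟨Φ p₀, M, hMpos, fun q hq r hr => hM _ _ ?_ ?_⟩
  -- Evaluating the fixed homomorphism at `i` shows that `q` commutes with `p₀ J p₀⁻¹`, i.e. that
  -- `p₀⁻¹ q p₀` commutes with `J`.
  · have hA : Matrix.GeneralLinearGroup.map σ (matrixOver q) =
        Φ (((groupH1 ψ G F).map (algebraMap ℚ ℝ) q).1) := by
      refine Units.ext (Matrix.ext fun i j => ?_)
      exact (RingHom.congr_fun (realPlace_comp_baseMap σ) _).symm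
    have h1 := congrArg (fun y : spaceY (groupH1 ψ G F) X => y.1.at unitI) hq
    have hid : ∀ g : ((GLFunctor n).weilRes F).obj ℝ,
        ((GLFunctor n).weilRes F).map (algebraMap ℝ ℝ) g = g :=
      ((GLFunctor n).weilRes F).map_id ℝ
    have h2 : ((groupH1 ψ G F).map (algebraMap ℚ ℝ) q).1 *
        (p₀ * ((GLFunctor n).toWeilRes F).app ℝ J * p₀⁻¹) *
        (((groupH1 ψ G F).map (algebraMap ℚ ℝ) q).1)⁻¹ =
        p₀ * ((GLFunctor n).toWeilRes F).app ℝ J * p₀⁻¹ := by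
      have h3 : ((GLFunctor n).weilRes F).map (algebraMap ℝ ℝ)
            ((groupH1 ψ G F).map (algebraMap ℚ ℝ) q).1 *
          (((GLFunctor n).weilRes F).map (algebraMap ℝ ℝ) p₀ *
            ((GLFunctor n).toWeilRes F).app ℝ J *
            (((GLFunctor n).weilRes F).map (algebraMap ℝ ℝ) p₀)⁻¹) *
          (((GLFunctor n).weilRes F).map (algebraMap ℝ ℝ)
            ((groupH1 ψ G F).map (algebraMap ℚ ℝ) q).1)⁻¹ =
          ((GLFunctor n).weilRes F).map (algebraMap ℝ ℝ) p₀ *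
            ((GLFunctor n).toWeilRes F).app ℝ J *
            (((GLFunctor n).weilRes F).map (algebraMap ℝ ℝ) p₀)⁻¹ := h1
      rwa [hid, hid] at h3
    have h4 := congrArg Φ h2
    simp only [map_mul, map_inv, hJ] at h4
    rw [hA]
    generalize Φ (((groupH1 ψ G F).map (algebraMap ℚ ℝ) q).1) = A at h4 ⊢
    generalize Φ p₀ = p at h4 ⊢
    rw [mul_inv_eq_iff_eq_mul] at h4
    calc p⁻¹ * A * p * J = p⁻¹ * (A * (p * J * p⁻¹)) * p := by group
      _ = J * (p⁻¹ * A * p) := by rw [h4]; group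
  -- Conjugation by `p₀` leaves the multiplier unchanged, as `s⁻¹ r s = r`.
  · obtain ⟨⟨-, s, hs⟩, -⟩ := hp₀
    have hs' := IsSimilitude.map (realPlace σ) hs
    rw [realPlace_tmul, map_one, mul_one] at hs'
    have hr' := IsSimilitude.map σ hr
    have hinv := IsSimilitude.inv (d := ((s⁻¹ : ℝˣ) : ℝ)) hs' (Units.inv_mul s)
    have := (hinv.mul hr').mul hs'
    have e : ((s⁻¹ : ℝˣ) : ℝ) * σ (algebraMap ℚ F r) * (s : ℝ) = r := by
      rw [mul_right_comm, Units.inv_mul, one_mul, eq_ratCast, map_ratCast]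
    rw [e] at this
    exact this

theorem exists_realEmbedding [NumberField.IsTotallyReal F] (φ : F →+* ℂ) :
    ∃ σ : F →+* ℝ, ∀ x, φ x = (σ x : ℂ) :=
  ⟨(NumberField.IsTotallyReal.complexEmbedding_isReal φ).embedding, fun x =>
    (NumberField.ComplexEmbedding.IsReal.coe_embedding_apply _ x).symm⟩

/-- A similitude whose positive powers have bounded denominators has no multiplier in `(0, 1)`. -/
theorem one_le_multiplier [Nonempty n] {ψ : Matrix n n ℚ} (hψ : ψ.det ≠ 0) {q : GL n F} {r : ℚ}
    (hq : IsSimilitude ψ q (algebraMap ℚ F r)) (hr : 0 < r) {D : ℕ} (hD : D ≠ 0)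
    (hint : ∀ (k : ℕ) (i j : n), IsIntegral ℤ (D • (q ^ k).val i j)) : 1 ≤ r := by
  by_contra! hr1
  obtain ⟨i, j, hij⟩ : ∃ i j, ψ i j ≠ 0 := by
    by_contra! h
    exact hψ (by rw [show ψ = 0 from Matrix.ext h, Matrix.det_zero])
  obtain ⟨E, hE, hEψ⟩ := exists_forall_of_finite
    (p := fun (t : n × n) E => IsIntegral ℤ (E • algebraMap ℚ F (ψ t.1 t.2)))
    (by
      rintro t D _ h ⟨c, rfl⟩
      rw [mul_comm, mul_smul]
      exact h.nsmul c)
    (fun t => ⟨(ψ t.1 t.2).den, (ψ t.1 t.2).den_ne_zero, by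
      rw [nsmul_eq_mul, ← map_natCast (algebraMap ℚ F), ← map_mul, Rat.den_mul_eq_num, map_intCast]
      exact isIntegral_algebraMap (A := F) (x := (ψ t.1 t.2).num)⟩)
  have hpow : ∀ k : ℕ, IsSimilitude ψ (q ^ k) (algebraMap ℚ F (r ^ k)) := by
    intro k
    induction k with
    | zero => simpa using IsSimilitude.one ψ F
    | succ k ih =>
      rw [pow_succ, pow_succ, map_mul]
      exact ih.mul hq
  -- Here `E` clears the entries of `ψ`, and each `D` one of the two copies of `q ^ k` in the
  -- similitude identity. Thus `t * r ^ k` is a nonzero integer for all `k`, which is impossible if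
  -- it tends to 0.
  set t : ℚ := D * E * D * ψ i j with ht
  have ht0 : t ≠ 0 := by positivity
  have hm : ∀ k : ℕ, ∃ m : ℤ, (m : ℚ) = t * r ^ k := by
    intro k
    have h : IsIntegral ℤ (algebraMap ℚ F (t * r ^ k)) := by
      have e := congrFun (congrFun (hpow k) i) j
      simp only [Matrix.mul_apply, Matrix.smul_apply, Matrix.map_apply, Matrix.transpose_apply,
        smul_eq_mul] at e
      have e' : algebraMap ℚ F (t * r ^ k) = ∑ b, (∑ a, (D • (q ^ k).val a i) *
          (E • algebraMap ℚ F (ψ a b))) * (D • (q ^ k).val b j) := by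
        have e1 : algebraMap ℚ F (t * r ^ k) =
            (D * E * D : F) * (algebraMap ℚ F (r ^ k) * algebraMap ℚ F (ψ i j)) := by
          rw [ht]; simp only [map_mul, map_natCast]; ring
        rw [e1, ← e, Finset.mul_sum]
        refine Finset.sum_congr rfl fun b _ => ?_
        rw [Finset.sum_mul, Finset.sum_mul, Finset.mul_sum]
        refine Finset.sum_congr rfl fun a _ => ?_
        simp only [nsmul_eq_mul]
        ring
      rw [e']
      exact IsIntegral.sum _ fun b _ => (IsIntegral.sum _ fun a _ =>
        (hint k a i).mul (hEψ (a, b))).mul (hint k b j)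
    rw [isIntegral_algebraMap_iff (algebraMap ℚ F).injective] at h
    exact IsIntegrallyClosed.isIntegral_iff.1 h
  obtain ⟨k, hk⟩ := exists_pow_lt_of_lt_one (show 0 < |t|⁻¹ by positivity) hr1
  obtain ⟨m, hm⟩ := hm k
  have h1 : |(m : ℚ)| < 1 := by
    rw [hm, abs_mul, abs_of_pos (pow_pos hr k)]
    calc |t| * r ^ k < |t| * |t|⁻¹ := by gcongr
      _ = 1 := mul_inv_cancel₀ (abs_ne_zero.2 ht0)
  have hm0 : m = 0 := by
    have : |m| < 1 := by exact_mod_cast h1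
    exact Int.abs_lt_one_iff.1 this
  rw [hm0, Int.cast_zero] at hm
  exact mul_ne_zero ht0 (pow_pos hr k).ne' hm.symm

/-- A group of rational points of `H₁` that stabilizes a point of `Y₁` and has bounded denominators
is finite. -/
theorem finite_of_stabilizer [NumberField.IsTotallyReal F] {ψ : Matrix n n ℚ} {G : LinAlgGroup ℚ n}
    {X : Set (DeligneHom (GLFunctor n))} (hψ : IsHodgeEmbedding ψ G X)
    (y : spaceY (groupH1 ψ G F) X) (S : Subgroup ((groupH1 ψ G F).obj ℚ))
    (hS : ∀ q ∈ S, q • y = y) {D : ℕ} (hD : D ≠ 0)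
    (hint : ∀ q ∈ S, ∀ i j, IsIntegral ℤ (D • (matrixOver q).val i j)) : Finite S := by
  -- The lower bound 1 holds for the multipliers of both `q` and `q⁻¹`. A single real place suffices
  -- here, as the multiplier is rational.
  have hmult : ∀ q ∈ S, IsSimilitude ψ (matrixOver q) (algebraMap ℚ F 1) := by
    rcases isEmpty_or_nonempty n with hn | hn
    · exact fun q _ => Subsingleton.elim _ _
    obtain ⟨φ⟩ : Nonempty (F →+* ℂ) := inferInstance
    obtain ⟨σ, -⟩ := exists_realEmbedding φ
    obtain ⟨p, M, hpos, hM⟩ := exists_definite_form_of_mem_spaceY hψ y σ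
    have hle : ∀ q ∈ S, ∀ r : ℚ, IsSimilitude ψ (matrixOver q) (algebraMap ℚ F r) → 1 ≤ r := by
      intro q hq r hr
      refine one_le_multiplier hψ.nondegenerate hr ?_ hD fun k i j => ?_
      · exact_mod_cast pos_of_similitude hpos (hM q (hS q hq) r hr)
      · rw [← map_pow]
        exact hint _ (pow_mem hq k) i j
    intro q hq
    obtain ⟨⟨-, r, hr⟩, -⟩ := q.2
    have hr' := IsSimilitude.map (lidHom F) hr
    rw [lidHom_tmul_one] at hr'
    have hinv := IsSimilitude.inv (d := algebraMap ℚ F ((r⁻¹ : ℚˣ) : ℚ)) hr'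
      (by rw [← map_mul, Units.inv_mul, map_one])
    have h1 : (1 : ℚ) ≤ (r : ℚ) := hle q hq _ hr'
    have h2 : (1 : ℚ) ≤ ((r⁻¹ : ℚˣ) : ℚ) := hle q⁻¹ (inv_mem hq) _ (by rw [map_inv]; exact hinv)
    have h3 : ((r⁻¹ : ℚˣ) : ℚ) * (r : ℚ) = 1 := Units.inv_mul r
    have h4 : (r : ℚ) = 1 := by nlinarith
    rw [← h4]
    exact hr'
  -- Total reality enters: every complex embedding is real, so the definite form bounds the entries
  -- at all of them.
  have hbound : ∀ φ : F →+* ℂ, ∃ B : ℝ, ∀ q ∈ S, ∀ i j, ‖φ ((matrixOver q).val i j)‖ ≤ B := by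
    intro φ
    obtain ⟨σ, hσ⟩ := exists_realEmbedding φ
    obtain ⟨p, M, hpos, hM⟩ := exists_definite_form_of_mem_spaceY hψ y σ
    obtain ⟨B, hB⟩ := exists_forall_abs_le_of_conj_isometry hpos p
    refine ⟨B, fun q hq i j => ?_⟩
    rw [hσ, Complex.norm_real]
    refine hB (Matrix.GeneralLinearGroup.map σ (matrixOver q)) ?_ i j
    rw [hM q (hS q hq) 1 (hmult q hq), Rat.cast_one, one_smul]
  choose B hB using hbound
  -- Finitely many algebraic integers have all conjugates bounded. The sum is one bound valid for
  -- every embedding, and `D` accounts for the cleared denominators.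
  have hfin := NumberField.Embeddings.finite_of_norm_le F ℂ (D * ∑ φ, |B φ|)
  have := hfin.to_subtype
  let f : S → n → n → {x : F | IsIntegral ℤ x ∧ ∀ φ : F →+* ℂ, ‖φ x‖ ≤ D * ∑ φ, |B φ|} :=
    fun q i j => ⟨D • (matrixOver q.1).val i j, hint q.1 q.2 i j, fun φ => by
      rw [map_nsmul, nsmul_eq_mul, norm_mul, Complex.norm_natCast]
      gcongr
      exact (hB φ q.1 q.2 i j).trans ((le_abs_self _).trans
        (Finset.single_le_sum (f := fun φ => |B φ|) (fun _ _ => abs_nonneg _)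
          (Finset.mem_univ φ)))⟩
  refine Finite.of_injective f fun a b hab => Subtype.ext (matrixOver_injective
    (Units.ext (Matrix.ext fun i j => ?_)))
  have h := congrArg Subtype.val (congrFun (congrFun hab i) j)
  exact smul_right_injective F hD h

theorem isOfFinOrder_of_mem_finite_subgroup {A : Type*} [Group A] (S : Subgroup A) [Finite S]
    {q : A} (hq : q ∈ S) : IsOfFinOrder q :=
  Submonoid.isOfFinOrder_coe.2 (isOfFinOrder_of_finite (⟨q, hq⟩ : S))

/-- `H₁(ℚ)` acts freely on `Y₁ × H₁(𝔸_f)/L₁` if the level away from `v` is neat. -/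
theorem shimuraAction_free [NumberField.IsTotallyReal F] {ψ : Matrix n n ℚ}
    {G : LinAlgGroup ℚ n} {X : Set (DeligneHom (GLFunctor n))} (hψ : IsHodgeEmbedding ψ G X)
    {v : HeightOneSpectrum ℤ} {Kaway : Subgroup ((groupH G F).obj (AfAway v))}
    (hKaway : IsCompact (Kaway : Set ((groupH G F).obj (AfAway v)))) (hneat : IsNeat Kaway)
    {Kat K₁at : Subgroup ((groupH G F).obj (Qv v))}
    (hKat : IsCompact (Kat : Set ((groupH G F).obj (Qv v)))) (hle : K₁at ≤ Kat)
    (hL : IsStable (F ≃ₐ[ℚ] F) (level (groupH1_le ψ G F) Kaway K₁at))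
    (a : (shimuraAction (groupH1 ψ G F) X (level (groupH1_le ψ G F) Kaway K₁at) hL).A)
    (x : (shimuraAction (groupH1 ψ G F) X (level (groupH1_le ψ G F) Kaway K₁at) hL).X)
    (hax : a • x = x) : a = 1 := by
  let 𝒮 := shimuraAction (groupH1 ψ G F) X (level (groupH1_le ψ G F) Kaway K₁at) hL
  obtain ⟨y, c⟩ := x
  induction c using QuotientGroup.induction_on with
  | H g =>
    let z : 𝒮.X := (y, QuotientGroup.mk g)
    -- The whole stabilizer is treated at once: the bounds make it a finite group, which is what
    -- gives `a` finite order.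
    obtain ⟨S, hS, haS⟩ : ∃ S : Subgroup ((groupH1 ψ G F).obj ℚ),
        (∀ q ∈ S, (show 𝒮.A from q) • z = z) ∧ a ∈ S :=
      ⟨(MulAction.stabilizer 𝒮.A z : Subgroup 𝒮.A), fun _ hq => hq, hax⟩
    let toH : (groupH1 ψ G F).obj ℚ →* (groupH G F).obj ℚ := incl (groupH1_le ψ G F) ℚ
    let gaway : (groupH G F).obj (AfAway v) :=
      incl (groupH1_le ψ G F) _ ((groupH1 ψ G F).map (Af.toAway v) g)
    let gat : (groupH G F).obj (Qv v) :=
      incl (groupH1_le ψ G F) _ ((groupH1 ψ G F).map (Af.toQv v) g)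
    have hSy : ∀ q ∈ S, q • y = y := fun q hq => congrArg Prod.fst (hS q hq)
    have hSlevel : ∀ q ∈ S, g⁻¹ * (groupH1 ψ G F).map (algebraMap ℚ Af) q * g ∈
        level (groupH1_le ψ G F) Kaway K₁at := by
      intro q hq
      have h : (QuotientGroup.mk ((groupH1 ψ G F).map (algebraMap ℚ Af) q * g) :
          (groupH1 ψ G F).obj Af ⧸ level (groupH1_le ψ G F) Kaway K₁at) = QuotientGroup.mk g :=
        congrArg Prod.snd (hS q hq)
      rw [mul_assoc]
      exact QuotientGroup.eq.1 h.symm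
    have haway : ∀ q ∈ S, gaway⁻¹ * (groupH G F).map (algebraMap ℚ (AfAway v)) (toH q) * gaway ∈
        Kaway := by
      intro q hq
      have h := Subgroup.mem_comap.1 (hSlevel q hq).1
      rw [map_mul, map_mul, map_inv, MonoidHom.comp_apply,
        MonoidHom.comp_apply, (groupH1 ψ G F).map_map,
        Subsingleton.elim ((Af.toAway v).comp (algebraMap ℚ Af)) (algebraMap ℚ (AfAway v))] at h
      exact h
    have hat : ∀ q ∈ S, gat⁻¹ * (groupH G F).map (algebraMap ℚ (Qv v)) (toH q) * gat ∈ Kat := by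
      intro q hq
      have h := Subgroup.mem_comap.1 (hSlevel q hq).2
      rw [map_mul, map_mul, map_inv, MonoidHom.comp_apply,
        MonoidHom.comp_apply, (groupH1 ψ G F).map_map,
        Subsingleton.elim ((Af.toQv v).comp (algebraMap ℚ Af)) (algebraMap ℚ (Qv v))] at h
      exact hle h
    -- Compactness bounds the denominators separately away from `v` and at `v`; `D₁ * D₂` then makes
    -- the entries integral at all finite places.
    obtain ⟨D₁, hD₁, hd₁⟩ := (AfAway.hasDenominators v).exists_isDenominator_conj
      (AfAway.isOpen_integers v) hKaway gaway
    obtain ⟨D₂, hD₂, hd₂⟩ := (Qv.hasDenominators v).exists_isDenominator_conj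
      (Qv.isOpen_integers v) hKat gat
    have hfin : Finite S := by
      refine finite_of_stabilizer hψ y S hSy (mul_ne_zero hD₁ hD₂) fun q hq i j => ?_
      rw [matrixOver_apply, ← map_nsmul]
      refine isIntegral_of_mem_integralTensor (v := v) ?_ ?_
      · rw [map_nsmul]
        exact nsmul_mem_of_dvd (hd₁ _ (haway q hq) i j) (dvd_mul_right _ _)
      · rw [map_nsmul]
        exact nsmul_mem_of_dvd (hd₂ _ (hat q hq) i j) (dvd_mul_left _ _)
    have hinj : Function.Injective toH := Subgroup.inclusion_injective (groupH1_le ψ G F ℚ)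
    have hfree : ∀ q ∈ S, q = 1 := fun q hq => by
      have hord : IsOfFinOrder q := isOfFinOrder_of_mem_finite_subgroup S hq
      -- Only the component of the level away from `v` has to be neat, since a rational element is
      -- determined by its image there.
      have h1 : toH q = 1 :=
        hneat.eq_one_of_isOfFinOrder gaway (MonoidHom.isOfFinOrder toH hord) (haway q hq)
      exact (map_eq_one_iff toH hinj).1 h1
    exact hfree a haS

end stabilizers

end PiatetskiShapiro

/-! ### Comparison of the stacks for `H₁` and `H` -/

open PiatetskiShapiro in
/-- `S₁` is `H₁(ℚ)` acting on `Y₁ × H₁(𝔸_f)/K₁^ℓ K_{1,ℓ}`, and `S` is `H(ℚ)` acting on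
`Y × H(𝔸_f)/K^ℓ K_{1,ℓ}`. The stack `[H₁(ℚ) \ Y₁ × H₁(𝔸_f)/K₁^ℓ K_{1,ℓ}]^{hΓ}` is equivalent to the
set of `Γ`-fixed points of the double coset space, and the functor `Φ` from that set to
`[H(ℚ) \ Y × H(𝔸_f)/K^ℓ K_{1,ℓ}]^{hΓ}` which is induced by `H₁ → H` (and is determined up to
isomorphism by this equivalence) is fully faithful and injective on isomorphism classes. -/
theorem proposition3p13 {n : Type} [Fintype n] [DecidableEq n]
    (ψ : Matrix n n ℚ) (G : LinAlgGroup ℚ n) (X : Set (DeligneHom (GLFunctor n)))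
    (hX : IsShimuraDatum G X) (hψ : IsHodgeEmbedding ψ G X)
    (F : Type) [Field F] [NumberField F] [IsGalois ℚ F] [NumberField.IsTotallyReal F]
    (ℓ : Nat.Primes) (hℓ : Nat.Coprime (ℓ : ℕ) (Nat.card (F ≃ₐ[ℚ] F)))
    (Kaway : Subgroup ((groupH G F).obj (AfAway (place ℓ))))
    (hgood : IsGoodCompactOpen (F ≃ₐ[ℚ] F) Kaway) (hneat : IsNeat Kaway)
    (Kat : Subgroup ((groupH G F).obj (Qv (place ℓ))))
    (hstable : IsStable (F ≃ₐ[ℚ] F) Kat) (hpro : IsProSubgroup (ℓ : ℕ) Kat) :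
    let K₁at := interSubgroup (groupH1 ψ G F) Kat
    let hK₁at := interSubgroup_stable (groupH1 ψ G F) hstable
    let L₁ := level (groupH1_le ψ G F) Kaway K₁at
    let L := level (P := groupH G F) (fun _ _ _ => le_rfl) Kaway K₁at
    let hL₁ := level_stable (groupH1_le ψ G F) hgood.stable hK₁at
    let hL := level_stable (P := groupH G F) (fun _ _ _ => le_rfl) hgood.stable hK₁at
    let S₁ := shimuraAction (groupH1 ψ G F) X L₁ hL₁
    let S := shimuraAction (groupH G F) X L hL
    let ι := shimuraMap (groupH1_le ψ G F) X hL₁ hL (level_le (groupH1_le ψ G F) Kaway K₁at)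
    S₁.toFixedOrbits.IsEquivalence ∧
      ∃ Φ : CategoryTheory.Discrete S₁.FixedOrbits ⥤ HFixed S,
        Nonempty (S₁.toFixedOrbits ⋙ Φ ≅ ι.hFixed) ∧ Φ.Full ∧ Φ.Faithful ∧
          ∀ a b, Nonempty (Φ.obj a ≅ Φ.obj b) → a = b := by
  intro K₁at hK₁at L₁ L hL₁ hL S₁ S ι
  have hequiv : S₁.toFixedOrbits.IsEquivalence := S₁.toFixedOrbits_isEquivalence
    (shimuraAction_free hψ hgood.isCompact hneat hpro.1 inf_le_left hL₁)
  refine ⟨hequiv, exists_fullyFaithful_factorization _ hequiv _ (ι.fullyFaithfulHFixed ?_ ?_ ?_)⟩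
  · exact Subgroup.inclusion_injective (groupH1_le ψ G F ℚ)
  -- Points of `Y₁` and `Y` are the same kind of homomorphism, and `L₁` is the preimage of `L` in
  -- `H₁(𝔸_f)`, so cosets stay distinct.
  · rintro ⟨⟨y, hy⟩, c⟩ ⟨⟨y', hy'⟩, c'⟩ h
    obtain ⟨h1, h2⟩ := Prod.ext_iff.1 h
    refine Prod.ext (Subtype.ext (congrArg (fun y : spaceY (groupH G F) X => y.1) h1)) ?_
    induction c using QuotientGroup.induction_on with
    | H g =>
      induction c' using QuotientGroup.induction_on with
      | H g' => exact QuotientGroup.eq.2 (QuotientGroup.eq.1 h2 :)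
  · rintro ⟨y, c⟩ ⟨y', c'⟩ b h
    induction c using QuotientGroup.induction_on with
    | H g =>
      induction c' using QuotientGroup.induction_on with
      | H g' =>
        have h2 : (QuotientGroup.mk ((groupH G F).map (algebraMap ℚ Af) b *
            incl (groupH1_le ψ G F) Af g) : (groupH G F).obj Af ⧸ L) =
            QuotientGroup.mk (incl (groupH1_le ψ G F) Af g') := (Prod.ext_iff.1 h).2
        -- The component of `g'⁻¹ b g` at `ℓ` lies in `H₁(ℚ_ℓ)`: this is where the level at `ℓ` for
        -- `H` has to be `K_{1,ℓ}` rather than all of `K_ℓ`.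
        have h3 := Subgroup.mem_subgroupOf.1
          (Subgroup.mem_comap.1 (QuotientGroup.eq.1 h2.symm).2).2
        have hQv : ((groupH G F).map (Af.toQv (place ℓ)) ((groupH G F).map (algebraMap ℚ Af) b)) =
            (groupH G F).map (algebraMap ℚ (Qv (place ℓ))) b :=
          ((groupH G F).map_map _ _ b).trans
            (congrArg (fun f => (groupH G F).map f b) (Subsingleton.elim _ _))
        have h4 : (((groupH1 ψ G F).map (Af.toQv (place ℓ)) g').1)⁻¹ *
            (((groupH G F).map (algebraMap ℚ (Qv (place ℓ))) b).1 *
              ((groupH1 ψ G F).map (Af.toQv (place ℓ)) g).1) ∈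
            (groupH1 ψ G F).obj (Qv (place ℓ)) := by
          rw [← hQv]
          rw [MonoidHom.comp_apply, map_mul, map_mul, map_inv, map_mul] at h3
          exact h3
        -- Both `g` and `g'` come from `H₁`, so they cancel and leave the rational element `b`
        -- itself in `H₁(ℚ_ℓ)`.
        rw [Subgroup.mul_mem_cancel_left _ (inv_mem (Subtype.prop _)),
          Subgroup.mul_mem_cancel_right _ (Subtype.prop _)] at h4
        exact ⟨⟨b.1, mem_groupH1_of_map hψ.nondegenerate hψ.le_GSp b h4⟩, rfl⟩
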